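/- Write $P_2(\mathbb R^d)$ for the Borel probability measures on $\mathbb R^d$ with finite second moment. For $\xi,\nu\in P_2(\mathbb R^d)$ let $\mathcal T_2(\xi,\nu)=\inf_{\pi}\int|x-y|^2\,d\pi(x,y)$, the infimum over all couplings $\pi$ of $\xi$ and $\nu$. Write $\mu\leqslant_{cx}\xi$ if $\int f\,d\mu\leqslant\int f\,d\xi$ for every convex $f:\mathbb R^d\to\mathbb R$ for which both integrals exist in the extended sense, and let $\mathrm P^{cx}_{2,\mu\leqslant}=\{\xi\in P_2(\mathbb R^d):\mu\leqslant_{cx}\xi\}$. A (forward) projection of $\nu$ onto $\mathrm P^{cx}_{2,\mu\leqslant}$ is an element of this cone at which $\inf\{\mathcal T_2(\eta,\nu):\eta\in\mathrm P^{cx}_{2,\mu\leqslant}\}$ is attained. A proper lower semicontinuous convex function $\phi:\mathbb R^d\to(-\infty,\infty]$ is called a convex expansion if $\phi=g^*$, where $g^*(y)=\sup_x\{x\cdot y-g(x)\}$, for some proper function $g:\mathbb R^d\to(-\infty,\infty]$ that is upper semicontinuous, almost everywhere finite and locally integrable, and satisfies $D^2g\leqslant Id$ in the sense of distributions, i.e.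 $\int g\,\partial_v\partial_v\eta\,dx\leqslant|v|^2\int\eta\,dx$ for all $v\in\mathbb R^d$ and all $0\leqslant\eta\in C_c^\infty(\mathbb R^d)$. Theorem. Let $\mu,\nu\in P_2(\mathbb R^d)$, with $\nu$ absolutely continuous with respect to Lebesgue measure. Then the following are equivalent. (i) The projection of $\nu$ onto $\mathrm P^{cx}_{2,\mu\leqslant}$ is $\mu$, that is, $\mu$ is the one and only projection. (i') $\mu$ is a projection of $\nu$ onto $\mathrm P^{cx}_{2,\mu\leqslant}$. (ii) There is a convex expansion $\phi$ which is finite in a neighbourhood of $y$ and differentiable at $y$ for $\nu$-almost every $y$, and such that $(\nabla\phi)_\#\nu=\mu$. -/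

import Mathlib

open MeasureTheory Filter Topology
open scoped ENNReal ContDiff

noncomputable section

namespace CxProj

/-- Borel probability measures on `ℝ^d` with finite second moment. -/
def P2 (d : ℕ) : Set (Measure (EuclideanSpace ℝ (Fin d))) :=
  {μ | IsProbabilityMeasure μ ∧ ∫⁻ x, ‖x‖ₑ ^ 2 ∂μ < ⊤}

/-- The couplings of `μ` and `ν` (first marginal `μ`, second marginal `ν`). -/
def couplings {d : ℕ} (μ ν : Measure (EuclideanSpace ℝ (Fin d))) :
    Set (Measure (EuclideanSpace ℝ (Fin d) × EuclideanSpace ℝ (Fin d))) :=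
  {π | π.map Prod.fst = μ ∧ π.map Prod.snd = ν}

/-- The quadratic transport cost: the infimum of `∫ |x - y|² dπ(x, y)` over couplings `π`. -/
def transportCost {d : ℕ} (μ ν : Measure (EuclideanSpace ℝ (Fin d))) : ℝ≥0∞ :=
  ⨅ π ∈ couplings μ ν, ∫⁻ p, ‖p.1 - p.2‖ₑ ^ 2 ∂π

/-- The integral of `f` exists in the extended sense: the integrals of the positive part and of
the negative part are not both infinite. -/
def HasExtIntegral {d : ℕ} (μ : Measure (EuclideanSpace ℝ (Fin d)))
    (f : EuclideanSpace ℝ (Fin d) → ℝ) : Prop :=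
  AEMeasurable f μ ∧
    (∫⁻ x, ENNReal.ofReal (f x) ∂μ ≠ ⊤ ∨ ∫⁻ x, ENNReal.ofReal (-f x) ∂μ ≠ ⊤)

/-- The extended-real integral `∫ f⁺ dμ - ∫ f⁻ dμ`. -/
def extIntegral {d : ℕ} (μ : Measure (EuclideanSpace ℝ (Fin d)))
    (f : EuclideanSpace ℝ (Fin d) → ℝ) : EReal :=
  ((∫⁻ x, ENNReal.ofReal (f x) ∂μ : ℝ≥0∞) : EReal) -
    ((∫⁻ x, ENNReal.ofReal (-f x) ∂μ : ℝ≥0∞) : EReal)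

/-- Convex order `μ ≤_cx ν` (used for probability measures with finite first moment). -/
def ConvexOrder {d : ℕ} (μ ν : Measure (EuclideanSpace ℝ (Fin d))) : Prop :=
  ∀ f : EuclideanSpace ℝ (Fin d) → ℝ, ConvexOn ℝ Set.univ f →
    HasExtIntegral μ f → HasExtIntegral ν f → extIntegral μ f ≤ extIntegral ν f

/-- The forward convex order cone `{ξ ∈ P₂(ℝ^d) : μ ≤_cx ξ}`. -/
def forwardCone {d : ℕ} (μ : Measure (EuclideanSpace ℝ (Fin d))) :
    Set (Measure (EuclideanSpace ℝ (Fin d))) :=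
  {ξ | ξ ∈ P2 d ∧ ConvexOrder μ ξ}

/-- The forward projections of `ν` onto the forward cone of `μ`: the elements of the cone at which
the infimum of the transport cost to `ν` is attained. -/
def forwardProjections {d : ℕ} (μ ν : Measure (EuclideanSpace ℝ (Fin d))) :
    Set (Measure (EuclideanSpace ℝ (Fin d))) :=
  {ξ | ξ ∈ forwardCone μ ∧ transportCost ξ ν = ⨅ η ∈ forwardCone μ, transportCost η ν}

/-- A proper function `ℝ^d → (-∞, ∞]`: never `-∞`, not identically `∞`. -/
def Proper {d : ℕ} (g : EuclideanSpace ℝ (Fin d) → EReal) : Prop :=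
  (∀ x, g x ≠ ⊥) ∧ ∃ x, g x ≠ ⊤

/-- Convexity of an extended-real-valued function: its epigraph is convex. -/
def ExtConvex {d : ℕ} (g : EuclideanSpace ℝ (Fin d) → EReal) : Prop :=
  Convex ℝ {p : EuclideanSpace ℝ (Fin d) × ℝ | g p.1 ≤ (p.2 : EReal)}

/-- The Legendre transform `g*(y) = sup_x (x · y - g(x))`. -/
def legendre {d : ℕ} (g : EuclideanSpace ℝ (Fin d) → EReal)
    (y : EuclideanSpace ℝ (Fin d)) : EReal :=
  ⨆ x, (((inner ℝ x y : ℝ) : EReal) - g x)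

/-- `D²g ≤ Id` in the sense of distributions: `g` is (almost everywhere finite and) locally
integrable, so that it is a distribution, and for every smooth compactly supported `η ≥ 0` and
every vector `v`, `∫ g ∂ᵥ∂ᵥη dx ≤ |v|² ∫ η dx`. -/
def HessianLeId {d : ℕ} (g : EuclideanSpace ℝ (Fin d) → EReal) : Prop :=
  (∀ᵐ x, g x ≠ ⊤ ∧ g x ≠ ⊥) ∧
  LocallyIntegrable (fun x => (g x).toReal) ∧
  ∀ η : EuclideanSpace ℝ (Fin d) → ℝ, ContDiff ℝ ∞ η → HasCompactSupport η → (∀ x, 0 ≤ η x) →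
    ∀ v : EuclideanSpace ℝ (Fin d),
      ∫ x, (g x).toReal * iteratedFDeriv ℝ 2 η x (fun _ => v) ≤ ‖v‖ ^ 2 * ∫ x, η x

/-- Convex expansions: proper lower semicontinuous convex functions that are the Legendre transform
of a proper function `g` with `D²g ≤ Id` in the sense of distributions. The distributional
inequality only sees `g` up to null sets, while the Legendre transform sees its point values;
upper semicontinuity says that `g` was not lowered on a null set. -/
def IsConvexExpansion {d : ℕ} (φ : EuclideanSpace ℝ (Fin d) → EReal) : Prop :=
  Proper φ ∧ LowerSemicontinuous φ ∧ ExtConvex φ ∧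
    ∃ g : EuclideanSpace ℝ (Fin d) → EReal,
      Proper g ∧ UpperSemicontinuous g ∧ HessianLeId g ∧ φ = legendre g

/-- An extended-real-valued function is differentiable at `y`: it is finite near `y` and
differentiable there as a real function. -/
def ExtDifferentiableAt {d : ℕ} (φ : EuclideanSpace ℝ (Fin d) → EReal)
    (y : EuclideanSpace ℝ (Fin d)) : Prop :=
  (∀ᶠ z in 𝓝 y, φ z ≠ ⊤ ∧ φ z ≠ ⊥) ∧ DifferentiableAt ℝ (fun z => (φ z).toReal) y

/-- The gradient, meaningful at points of differentiability. -/
def extGradient {d : ℕ} (φ : EuclideanSpace ℝ (Fin d) → EReal)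
    (y : EuclideanSpace ℝ (Fin d)) : EuclideanSpace ℝ (Fin d) :=
  gradient (fun z => (φ z).toReal) y

/-- `(∇φ)_# ν = μ`, where `∇φ` is defined `ν`-almost everywhere. -/
def GradientPushesForward {d : ℕ} (φ : EuclideanSpace ℝ (Fin d) → EReal)
    (ν μ : Measure (EuclideanSpace ℝ (Fin d))) : Prop :=
  (∀ᵐ y ∂ν, ExtDifferentiableAt φ y) ∧ ν.map (extGradient φ) = μ

end CxProj

end

/-! Write `G x = ‖x‖²/2 - H x` with `H` convex; up to null sets these are exactly the functions with
`D²G ≤ Id`, and for an upper semicontinuous `g` the Legendre transform does not see the null set. So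
convex expansions are transforms of such `G`, and `H` serves as the dual potential.

From a convex expansion to unique projection: where `φ = G*` is differentiable at `y`, the supremum
defining `φ y` is attained exactly at `x = ∇φ(y)`. Completing squares, `H x - H (∇φ y) ≤ ‖x - y‖²/2
- ‖∇φ y - y‖²/2` for all `x`, with equality only at `∇φ y`. Integrated over a coupling of `η` and
`ν`, the left side gives `∫ H dη - ∫ H dμ ≥ 0`, since `μ ≤_cx η`. Hence no `η` in the cone costs
less than `μ`, and equality concentrates the coupling on the graph of `∇φ`, so `η = μ`. See
`IsConvexExpansion.exists_potential` and `forwardProjections_eq_singleton_of_potential`.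

From projection to convex expansion: let `(X, Y)` be an optimal coupling and let `Y'` also have law
`ν`. Splitting `X` into `X - r(Y' - Y)` and `X - Y + Y'`, with barycentre `X`, gives a competitor in
the cone; to first order in `r`, minimality says `E⟪X - Y, Y' - Y⟫ ≤ 0`
(`integral_inner_sub_nonpos_of_projection`). Taking for `Y'` a permutation of independent samples
makes `{(x - y, y)}` cyclically monotone on the support (`sum_inner_nonpos_of_mem_support`).
Rockafellar's theorem yields a convex `ψ` with `x - y ∈ ∂ψ(y)`, and `φ = ‖·‖²/2 + ψ` is a convex
expansion with `x ∈ ∂φ(y)`. Absolute continuity of `ν` turns the subgradient into the gradient. -/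

namespace CxProj

set_option linter.unusedSectionVars false

/-! ### Distributional Hessian bounds and convexity along lines -/

section Hessian

variable {E : Type*} [NormedAddCommGroup E] [InnerProductSpace ℝ E] [FiniteDimensional ℝ E]
  [MeasurableSpace E] [BorelSpace E]

lemma integrable_mul_translate {m : Measure E} {g η : E → ℝ} (hg : LocallyIntegrable g m)
    (hη : Continuous η) (hc : HasCompactSupport η) (w : E) :
    Integrable (fun x => g x * η (x + w)) m := by
  have := hg.integrable_smul_left_of_hasCompactSupport (g := fun x => η (x + w))
    (by fun_prop) (hc.comp_homeomorph (Homeomorph.addRight w))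
  simpa [smul_eq_mul, mul_comm] using this

/-- Differentiation under the integral of a translated test function. -/
lemma hasDerivAt_integral_translate {m : Measure E} {g η : E → ℝ} (hg : LocallyIntegrable g m)
    (hη : ContDiff ℝ 1 η) (hc : HasCompactSupport η) (v : E) (t : ℝ) :
    HasDerivAt (fun s : ℝ => ∫ x, g x * η (x + s • v) ∂m)
      (∫ x, g x * fderiv ℝ η (x + t • v) v ∂m) t := by
  have hη' : Continuous (fun x => fderiv ℝ η x v) :=
    (hη.continuous_fderiv (by norm_num)).clm_apply continuous_const
  have hc' : HasCompactSupport (fun x => fderiv ℝ η x v) := hc.fderiv_apply (𝕜 := ℝ) v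
  obtain ⟨C, hC⟩ := hc'.exists_bound_of_continuous hη'
  -- `K` contains the support of every translated derivative with `|s - t| ≤ 1`, so `C * ‖g‖` on
  -- this compact set is an integrable bound.
  set K : Set E := (fun p : E × ℝ => p.1 - p.2 • v) ''
    (tsupport (fun x => fderiv ℝ η x v) ×ˢ Metric.closedBall t 1) with hK
  have hKc : IsCompact K :=
    (hc'.isCompact.prod (isCompact_closedBall t 1)).image (by fun_prop)
  refine (hasDerivAt_integral_of_dominated_loc_of_deriv_le
    (F' := fun s x => g x * fderiv ℝ η (x + s • v) v)
    (bound := K.indicator (fun x => ‖g x‖ * C)) (Metric.ball_mem_nhds t one_pos)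
    (Eventually.of_forall fun s =>
      (integrable_mul_translate hg hη.continuous hc (s • v)).aestronglyMeasurable)
    (integrable_mul_translate hg hη.continuous hc (t • v))
    (integrable_mul_translate hg hη' hc' (t • v)).aestronglyMeasurable ?_ ?_ ?_).2
  · refine Eventually.of_forall fun x s hs => ?_
    by_cases hx : x ∈ K
    · rw [Set.indicator_of_mem hx, norm_mul]
      exact mul_le_mul_of_nonneg_left (hC _) (norm_nonneg _)
    · rw [Set.indicator_of_notMem hx]
      have : fderiv ℝ η (x + s • v) v = 0 := by
        by_contra h
        refine hx ⟨(x + s • v, s), ⟨subset_tsupport _ h, Metric.ball_subset_closedBall hs⟩, ?_⟩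
        simp
      simp [this]
  · rw [integrable_indicator_iff hKc.measurableSet]
    exact ((hg.integrableOn_isCompact hKc).norm.mul_const C)
  · refine Eventually.of_forall fun x s _ => ?_
    have h1 : HasDerivAt (fun s : ℝ => x + s • v) v s := by
      simpa using ((hasDerivAt_id s).smul_const v).const_add x
    have h2 := ((hη.differentiable (by norm_num)) (x + s • v)).hasFDerivAt.comp_hasDerivAt s h1
    exact h2.const_mul (g x)

lemma iteratedFDeriv_two_diag {η : E → ℝ} (hη : ContDiff ℝ ∞ η) (x v : E) :
    iteratedFDeriv ℝ 2 η x (fun _ => v) = fderiv ℝ (fun y => fderiv ℝ η y v) x v := by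
  rw [iteratedFDeriv_two_apply, fderiv_clm_apply]
  · simp
  · exact (hη.fderiv_right (m := ∞) (by simp)).differentiable (by simp) x
  · exact differentiableAt_const _

lemma contDiff_fderiv_const {η : E → ℝ} (hη : ContDiff ℝ ∞ η) (v : E) :
    ContDiff ℝ ∞ (fun y => fderiv ℝ η y v) :=
  (hη.fderiv_right (m := ∞) (by simp)).clm_apply contDiff_const

/-- The first two derivatives of a quadratic minus the pairing with translates of a test
function. -/
lemma hasDerivAt_quadratic_sub_pairing {m : Measure E} {g η : E → ℝ} (hg : LocallyIntegrable g m)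
    (hη : ContDiff ℝ ∞ η) (hc : HasCompactSupport η) (v : E) (c t : ℝ) :
    HasDerivAt (fun s : ℝ => c * s ^ 2 / 2 - ∫ x, g x * η (x + s • v) ∂m)
        (c * t - ∫ x, g x * fderiv ℝ η (x + t • v) v ∂m) t ∧
      HasDerivAt (fun s : ℝ => c * s - ∫ x, g x * fderiv ℝ η (x + s • v) v ∂m)
        (c - ∫ x, g x * iteratedFDeriv ℝ 2 η (x + t • v) (fun _ => v) ∂m) t := by
  constructor
  · have h1 : HasDerivAt (fun s : ℝ => c * s ^ 2 / 2) (c * t) t := by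
      have := ((hasDerivAt_pow 2 t).const_mul c).div_const 2
      refine this.congr_deriv ?_
      simp; ring
    exact h1.sub (hasDerivAt_integral_translate hg (hη.of_le (by simp)) hc v t)
  · have h1 : HasDerivAt (fun s : ℝ => c * s) c t := by
      simpa using (hasDerivAt_id t).const_mul c
    have h2 := hasDerivAt_integral_translate hg
      ((contDiff_fderiv_const hη v).of_le (by simp)) (hc.fderiv_apply (𝕜 := ℝ) v) v t
    simp only [iteratedFDeriv_two_diag hη]
    exact h1.sub h2

lemma norm_sq_convex_combo (x y : E) {a b : ℝ} (hab : a + b = 1) :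
    ‖a • x + b • y‖ ^ 2 = a * ‖x‖ ^ 2 + b * ‖y‖ ^ 2 - a * b * ‖x - y‖ ^ 2 := by
  obtain rfl : b = 1 - a := by linarith
  rw [norm_add_sq_real, norm_sub_sq_real, norm_smul, norm_smul, inner_smul_left, inner_smul_right,
    mul_pow, mul_pow, Real.norm_eq_abs, Real.norm_eq_abs, sq_abs, sq_abs]
  simp
  ring

/-- `|x|²/2 - H` has distributional Hessian at most the identity when `H` is convex. -/
lemma integral_hessian_le_of_convexOn {m : Measure E} [m.IsAddHaarMeasure] {H η : E → ℝ}
    (hH : ConvexOn ℝ Set.univ H) (hη : ContDiff ℝ ∞ η) (hc : HasCompactSupport η)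
    (h0 : ∀ x, 0 ≤ η x) (v : E) :
    ∫ x, (‖x‖ ^ 2 / 2 - H x) * iteratedFDeriv ℝ 2 η x (fun _ => v) ∂m
      ≤ ‖v‖ ^ 2 * ∫ x, η x ∂m := by
  have hHc : Continuous H := hH.locallyLipschitz.continuous
  set g : E → ℝ := fun x => ‖x‖ ^ 2 / 2 - H x with hgdef
  have hgc : Continuous g := by fun_prop
  have hg : LocallyIntegrable g m := hgc.locallyIntegrable
  set c : ℝ := ‖v‖ ^ 2 * ∫ x, η x ∂m
  have hd := hasDerivAt_quadratic_sub_pairing hg hη hc v c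
  set Θ : ℝ → ℝ := fun s : ℝ => c * s ^ 2 / 2 - ∫ x, g x * η (x + s • v) ∂m with hΘ
  have hηi : Integrable η m := hη.continuous.integrable_of_hasCompactSupport hc
  have hi : ∀ s : ℝ, Integrable (fun x => g (x - s • v) * η x) m := fun s =>
    ((hgc.comp (by fun_prop : Continuous fun x => x - s • v)).mul
      hη.continuous).integrable_of_hasCompactSupport hc.mul_left
  -- With the translation moved onto `g`, the coefficient of `η x` is an affine function of `s` plus
  -- `H (x - s • v)`, so `Θ` is convex; its second derivative at `0` is the claimed difference.
  have hΘ' : ∀ s, Θ s = ∫ x, (‖v‖ ^ 2 * s ^ 2 / 2 - g (x - s • v)) * η x ∂m := by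
    intro s
    have : ∫ x, g x * η (x + s • v) ∂m = ∫ x, g (x - s • v) * η x ∂m := by
      rw [← integral_sub_right_eq_self (fun x => g x * η (x + s • v)) (s • v)]
      simp
    simp only [hΘ, this, sub_mul]
    rw [integral_sub (hηi.const_mul _) (hi s), integral_const_mul]
    simp only [c]; ring
  have hi' : ∀ s : ℝ, Integrable (fun x => (‖v‖ ^ 2 * s ^ 2 / 2 - g (x - s • v)) * η x) m := by
    intro s
    simp only [sub_mul]
    exact (hηi.const_mul _).sub (hi s)
  have hconv : ConvexOn ℝ Set.univ Θ := by
    refine ⟨convex_univ, fun s _ t _ a b ha hb hab => ?_⟩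
    rw [hΘ', hΘ', hΘ', smul_eq_mul, smul_eq_mul, smul_eq_mul, smul_eq_mul, ← integral_const_mul,
      ← integral_const_mul, ← integral_add ((hi' s).const_mul a) ((hi' t).const_mul b)]
    refine integral_mono (hi' _) (((hi' s).const_mul a).add ((hi' t).const_mul b)) fun x => ?_
    simp only
    have hx : x - (a * s + b * t) • v = a • (x - s • v) + b • (x - t • v) := by
      obtain rfl : b = 1 - a := by linarith
      module
    have h1 := norm_sq_convex_combo (x - s • v) (x - t • v) hab
    have h2 := hH.2 (Set.mem_univ (x - s • v)) (Set.mem_univ (x - t • v)) ha hb hab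
    have h3 : ‖(x - s • v) - (x - t • v)‖ ^ 2 = (t - s) ^ 2 * ‖v‖ ^ 2 := by
      rw [show (x - s • v) - (x - t • v) = (t - s) • v by module, norm_smul, mul_pow,
        Real.norm_eq_abs, sq_abs]
    rw [h3] at h1
    simp only [smul_eq_mul] at h2
    rw [← mul_assoc, ← mul_assoc, ← add_mul]
    refine mul_le_mul_of_nonneg_right ?_ (h0 x)
    simp only [hgdef]
    rw [hx, h1]
    obtain rfl : b = 1 - a := by linarith
    nlinarith [h2]
  have hderiv : deriv Θ = fun t => c * t - ∫ x, g x * fderiv ℝ η (x + t • v) v ∂m :=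
    funext fun t => (hd t).1.deriv
  have hmono : Monotone (deriv Θ) := by
    rw [← monotoneOn_univ]
    exact hconv.monotoneOn_deriv fun t _ => (hd t).1.differentiableAt
  have h2 : 0 ≤ deriv (deriv Θ) 0 := hmono.deriv_nonneg
  rw [hderiv, (hd 0).2.deriv] at h2
  simpa using h2

/-- A distributional Hessian bound makes the pairing with translates of a test function concave up
to a quadratic. -/
lemma convexOn_quadratic_sub_pairing {m : Measure E} [m.IsAddHaarMeasure] {g η : E → ℝ}
    (hg : LocallyIntegrable g m)
    (hH : ∀ η : E → ℝ, ContDiff ℝ ∞ η → HasCompactSupport η → (∀ x, 0 ≤ η x) → ∀ v : E,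
      ∫ x, g x * iteratedFDeriv ℝ 2 η x (fun _ => v) ∂m ≤ ‖v‖ ^ 2 * ∫ x, η x ∂m)
    (hη : ContDiff ℝ ∞ η) (hc : HasCompactSupport η) (h0 : ∀ x, 0 ≤ η x) (v : E) :
    ConvexOn ℝ Set.univ
      (fun s : ℝ => (‖v‖ ^ 2 * ∫ x, η x ∂m) * s ^ 2 / 2 - ∫ x, g x * η (x + s • v) ∂m) := by
  have hd := hasDerivAt_quadratic_sub_pairing hg hη hc v (‖v‖ ^ 2 * ∫ x, η x ∂m)
  have hderiv := funext fun t => (hd t).1.deriv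
  refine convexOn_univ_of_deriv2_nonneg (fun t => (hd t).1.differentiableAt) ?_ ?_
  · rw [hderiv]; exact fun t => (hd t).2.differentiableAt
  · intro t
    simp only [Function.iterate_succ, Function.iterate_zero, Function.comp, id]
    rw [hderiv, (hd t).2.deriv]
    have h := hH (fun x => η (x + t • v)) (hη.comp (contDiff_id.add contDiff_const))
      (hc.comp_homeomorph (Homeomorph.addRight (t • v))) (fun x => h0 _) v
    rw [integral_add_right_eq_self η (t • v)] at h
    simp only [iteratedFDeriv_comp_add_right] at h
    linarith

end Hessian

/-! ### From the distributional bound to a convex function by mollification -/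

section Mollify

variable {E : Type*} [NormedAddCommGroup E] [InnerProductSpace ℝ E] [FiniteDimensional ℝ E]
  [MeasurableSpace E] [BorelSpace E]

/-- An almost everywhere limit of convex functions agrees almost everywhere with a convex
function. -/
lemma exists_convexOn_ae_eq_of_tendsto {m : Measure E} [m.IsAddHaarMeasure] {H : ℕ → E → ℝ}
    {h : E → ℝ} (hH : ∀ n, ConvexOn ℝ Set.univ (H n))
    (hlim : ∀ᵐ x ∂m, Tendsto (fun n => H n x) atTop (𝓝 (h x))) :
    ∃ K : E → ℝ, ConvexOn ℝ Set.univ K ∧ ∀ᵐ x ∂m, K x = h x := by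
  -- Every `x` is the midpoint of `x + y` and `x - y`, and for almost every `y` both are points of
  -- convergence.
  have hupper : ∀ x, BddAbove (Set.range fun n => H n x) := by
    intro x
    have h1 := (measurePreserving_add_left m x).quasiMeasurePreserving.ae hlim
    have h2 := (Measure.measurePreserving_sub_left m x).quasiMeasurePreserving.ae hlim
    obtain ⟨y, hy1, hy2⟩ := (h1.and h2).exists
    obtain ⟨A, hA⟩ := hy1.bddAbove_range
    obtain ⟨B, hB⟩ := hy2.bddAbove_range
    refine ⟨(1 / 2 : ℝ) * A + (1 / 2 : ℝ) * B, ?_⟩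
    rintro _ ⟨n, rfl⟩
    have h3 := (hH n).2 (Set.mem_univ (x + y)) (Set.mem_univ (x - y))
      (by norm_num : (0 : ℝ) ≤ 1 / 2) (by norm_num : (0 : ℝ) ≤ 1 / 2) (by norm_num)
    rw [show (1 / 2 : ℝ) • (x + y) + (1 / 2 : ℝ) • (x - y) = x by module] at h3
    have h4 : H n (x + y) ≤ A := hA ⟨n, rfl⟩
    have h5 : H n (x - y) ≤ B := hB ⟨n, rfl⟩
    simp only [smul_eq_mul] at h3
    simp only
    linarith
  -- A point of convergence `z` is the midpoint of `x` and its reflection `2z - x`, where the upper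
  -- bound applies.
  have hlower : ∀ x, BddBelow (Set.range fun n => H n x) := by
    intro x
    obtain ⟨z, hz⟩ := hlim.exists
    obtain ⟨A, hA⟩ := hz.bddBelow_range
    obtain ⟨B, hB⟩ := hupper ((2 : ℝ) • z - x)
    refine ⟨2 * A - B, ?_⟩
    rintro _ ⟨n, rfl⟩
    have h3 := (hH n).2 (Set.mem_univ x) (Set.mem_univ ((2 : ℝ) • z - x))
      (by norm_num : (0 : ℝ) ≤ 1 / 2) (by norm_num : (0 : ℝ) ≤ 1 / 2) (by norm_num)
    rw [show (1 / 2 : ℝ) • x + (1 / 2 : ℝ) • ((2 : ℝ) • z - x) = z by module] at h3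
    have h4 : A ≤ H n z := hA ⟨n, rfl⟩
    have h5 : H n ((2 : ℝ) • z - x) ≤ B := hB ⟨n, rfl⟩
    simp only [smul_eq_mul] at h3
    simp only
    linarith
  have hU : ((hyperfilter ℕ : Ultrafilter ℕ) : Filter ℕ) ≤ atTop := Nat.hyperfilter_le_atTop
  -- The bounded sequences converge along an ultrafilter at every point. Such a limit keeps
  -- convexity everywhere and agrees with `h` wherever the ordinary limit exists.
  have hex : ∀ x, ∃ l, Tendsto (fun n => H n x) (hyperfilter ℕ : Filter ℕ) (𝓝 l) := by
    intro x
    obtain ⟨A, hA⟩ := hlower x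
    obtain ⟨B, hB⟩ := hupper x
    have := (isCompact_Icc (a := A) (b := B)).ultrafilter_le_nhds
      ((hyperfilter ℕ).map fun n => H n x) (by
        rw [le_principal_iff]
        exact eventually_map.2 (Eventually.of_forall fun n => ⟨hA (Set.mem_range_self (f := fun n => H n x) n),
          hB (Set.mem_range_self (f := fun n => H n x) n)⟩))
    obtain ⟨l, -, hl⟩ := this
    exact ⟨l, hl⟩
  choose K hK using hex
  refine ⟨K, ⟨convex_univ, fun x _ y _ a b ha hb hab => ?_⟩, ?_⟩
  · exact le_of_tendsto_of_tendsto' (hK _) (((hK x).const_smul a).add ((hK y).const_smul b))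
      fun n => (hH n).2 (Set.mem_univ _) (Set.mem_univ _) ha hb hab
  · filter_upwards [hlim] with x hx
    exact tendsto_nhds_unique (hK x) (hx.mono_left hU)

/-- A locally integrable function whose distributional Hessian is at most the identity is almost
everywhere `|x|²/2` minus a convex function. -/
lemma exists_convexOn_ae_eq_of_hessian_le {m : Measure E} [m.IsAddHaarMeasure] {g : E → ℝ}
    (hg : LocallyIntegrable g m)
    (hH : ∀ η : E → ℝ, ContDiff ℝ ∞ η → HasCompactSupport η → (∀ x, 0 ≤ η x) → ∀ v : E,
      ∫ x, g x * iteratedFDeriv ℝ 2 η x (fun _ => v) ∂m ≤ ‖v‖ ^ 2 * ∫ x, η x ∂m) :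
    ∃ H : E → ℝ, ConvexOn ℝ Set.univ H ∧ ∀ᵐ x ∂m, g x = ‖x‖ ^ 2 / 2 - H x := by
  let φ : ℕ → ContDiffBump (0 : E) := fun n =>
    { rIn := 1 / ((n : ℝ) + 1), rOut := 2 * (1 / ((n : ℝ) + 1)),
      rIn_pos := by positivity
      rIn_lt_rOut := by
        have : (0 : ℝ) < 1 / ((n : ℝ) + 1) := by positivity
        linarith }
  have hφ0 : Tendsto (fun n => (φ n).rOut) atTop (𝓝 0) := by
    simpa [φ] using (tendsto_one_div_add_atTop_nhds_zero_nat (𝕜 := ℝ)).const_mul (2 : ℝ)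
  have hlim := ContDiffBump.ae_convolution_tendsto_right_of_locallyIntegrable hφ0
    (K := 2) (Eventually.of_forall fun n => le_refl _) hg
  set G : ℕ → E → ℝ := fun n x => ∫ z, g z * (φ n).normed m (z - x) ∂m with hG
  have hGeq : ∀ n x, convolution ((φ n).normed m) g (ContinuousLinearMap.lsmul ℝ ℝ) m x = G n x := by
    intro n x
    rw [convolution_lsmul_swap]
    refine integral_congr_ae (Eventually.of_forall fun z => ?_)
    simp only [smul_eq_mul]
    rw [← neg_sub z x, ContDiffBump.normed_neg, mul_comm]
  simp only [hGeq] at hlim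
  have hconv : ∀ n, ConvexOn ℝ Set.univ (fun x => ‖x‖ ^ 2 / 2 - G n x) := by
    intro n
    refine ⟨convex_univ, fun x _ y _ a b ha hb hab => ?_⟩
    -- Shifting the test function by `s • (x - y)` moves the evaluation point of `G n` from `x` to
    -- `x + s • (y - x)`, so this is convexity along the segment from `x` to `y`.
    have hc := convexOn_quadratic_sub_pairing hg hH (η := fun z => (φ n).normed m (z - x))
      ((φ n).contDiff_normed.comp (contDiff_id.sub contDiff_const))
      ((φ n).hasCompactSupport_normed.comp_homeomorph (Homeomorph.subRight x))
      (fun z => (φ n).nonneg_normed _) (x - y)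
    have hint : ∫ z, (φ n).normed m (z - x) ∂m = 1 := by
      rw [integral_sub_right_eq_self ((φ n).normed m) x, (φ n).integral_normed]
    have hGs : ∀ s : ℝ, ∫ z, g z * (φ n).normed m (z + s • (x - y) - x) ∂m
        = G n (x + s • (y - x)) := by
      intro s
      simp only [hG]
      congr 1; ext z; congr 2; module
    simp only [hint, hGs] at hc
    have h2 := hc.2 (Set.mem_univ 0) (Set.mem_univ 1) ha hb hab
    have e1 : a • x + b • y = x + b • (y - x) := by
      obtain rfl : a = 1 - b := by linarith
      module
    have e2 := norm_sq_convex_combo x y hab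
    simp only [smul_eq_mul, mul_zero, zero_smul, add_zero, mul_one, zero_add, one_smul,
      add_sub_cancel] at h2
    simp only [smul_eq_mul]
    rw [e2, e1]
    obtain rfl : a = 1 - b := by linarith
    nlinarith [h2]
  obtain ⟨H, hHc, hHe⟩ := exists_convexOn_ae_eq_of_tendsto (m := m)
    (h := fun x => ‖x‖ ^ 2 / 2 - g x) hconv (by
      filter_upwards [hlim] with x hx
      exact hx.const_sub _)
  refine ⟨H, hHc, ?_⟩
  filter_upwards [hHe] with x hx
  linarith

end Mollify

/-! ### Existence of optimal couplings -/

section OptimalCoupling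

variable {d : ℕ}

local notation "𝔼" => EuclideanSpace ℝ (Fin d)

lemma isProbabilityMeasure_of_mem_couplings {μ ν : Measure 𝔼} [IsProbabilityMeasure μ]
    {π : Measure (𝔼 × 𝔼)} (h : π ∈ couplings μ ν) : IsProbabilityMeasure π := by
  have : IsProbabilityMeasure (π.map Prod.fst) := by rw [h.1]; infer_instance
  exact Measure.isProbabilityMeasure_of_map (f := Prod.fst) (μ := π)

/-- The integral is the supremum of the integrals of the truncations `min f n`, which are bounded
and continuous and hence integrate weakly continuously. -/
lemma lowerSemicontinuous_lintegral_probabilityMeasure {X : Type*} [TopologicalSpace X]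
    [MeasurableSpace X] [OpensMeasurableSpace X] {f : X → ℝ≥0∞} (hf : Continuous f)
    (hfin : ∀ x, f x ≠ ⊤) :
    LowerSemicontinuous fun π : ProbabilityMeasure X => ∫⁻ x, f x ∂(π : Measure X) := by
  have hmono : Monotone fun (n : ℕ) (x : X) => min (f x) n := by
    intro n k hnk x
    exact min_le_min le_rfl (by exact_mod_cast hnk)
  have h : ∀ π : ProbabilityMeasure X,
      ∫⁻ x, f x ∂(π : Measure X) = ⨆ n : ℕ, ∫⁻ x, min (f x) n ∂(π : Measure X) := by
    intro π
    rw [← lintegral_iSup (fun n => (hf.min continuous_const).measurable) hmono]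
    refine lintegral_congr fun x => ?_
    obtain ⟨n, hn⟩ := ENNReal.exists_nat_gt (hfin x)
    refine le_antisymm (le_iSup_of_le n (by simp [hn.le])) (iSup_le fun n => min_le_left _ _)
  simp only [h]
  refine lowerSemicontinuous_iSup fun n => Continuous.lowerSemicontinuous ?_
  have hb : ∀ x, min (f x) n ≠ ⊤ := fun x => ((min_le_right _ _).trans_lt (by simp)).ne
  let F : BoundedContinuousFunction X NNReal :=
    BoundedContinuousFunction.mkOfBound
      ⟨fun x => (min (f x) n).toNNReal, by
        exact ENNReal.continuousOn_toNNReal.comp_continuous (hf.min continuous_const) hb⟩ n (by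
      intro x y
      rw [NNReal.dist_eq]
      have h1 : ∀ x, (((min (f x) n).toNNReal : NNReal) : ℝ) ≤ n := by
        intro x
        have : (min (f x) n).toNNReal ≤ n :=
          ENNReal.toNNReal_mono (b := ((n : NNReal) : ℝ≥0∞)) (by simp) (by simp)
        exact_mod_cast this
      have h2 := h1 x
      have h3 := h1 y
      rw [abs_le]
      constructor <;> simp only [ContinuousMap.coe_mk] <;>
        linarith [(min (f x) n).toNNReal.2, (min (f y) n).toNNReal.2])
  have h2 : ∀ π : ProbabilityMeasure X, ∫⁻ x, min (f x) n ∂(π : Measure X)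
      = ∫⁻ x, F x ∂(π : Measure X) := by
    intro π
    refine lintegral_congr fun x => ?_
    exact (ENNReal.coe_toNNReal (hb x)).symm
  simp only [h2]
  have h3 := ProbabilityMeasure.continuous_testAgainstNN_eval F
  have h4 := ENNReal.continuous_coe.comp h3
  refine h4.congr fun π => ?_
  simp [FiniteMeasure.testAgainstNN_coe_eq]

/-- The infimum in the transport cost is attained. -/
lemma exists_optimal_coupling (μ ν : Measure 𝔼) [IsProbabilityMeasure μ] [IsProbabilityMeasure ν] :
    ∃ π ∈ couplings μ ν, ∫⁻ p, ‖p.1 - p.2‖ₑ ^ 2 ∂π = transportCost μ ν := by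
  set C : Set (ProbabilityMeasure (𝔼 × 𝔼)) := {π | (π : Measure (𝔼 × 𝔼)) ∈ couplings μ ν} with hC
  let μ' : ProbabilityMeasure 𝔼 := ⟨μ, inferInstance⟩
  let ν' : ProbabilityMeasure 𝔼 := ⟨ν, inferInstance⟩
  have hclosed : IsClosed C := by
    have h1 : Continuous fun π : ProbabilityMeasure (𝔼 × 𝔼) =>
        π.map (f := Prod.fst) measurable_fst.aemeasurable :=
      ProbabilityMeasure.continuous_map continuous_fst
    have h2 : Continuous fun π : ProbabilityMeasure (𝔼 × 𝔼) =>
        π.map (f := Prod.snd) measurable_snd.aemeasurable :=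
      ProbabilityMeasure.continuous_map continuous_snd
    have h3 := (isClosed_eq h1 (continuous_const (y := μ'))).inter
      (isClosed_eq h2 (continuous_const (y := ν')))
    convert h3 using 1
    ext π
    exact and_congr (Subtype.ext_iff (a1 := π.map measurable_fst.aemeasurable) (a2 := μ')).symm
      (Subtype.ext_iff (a1 := π.map measurable_snd.aemeasurable) (a2 := ν')).symm
  have htight : IsTightMeasureSet {x | ∃ π ∈ C, (π : Measure (𝔼 × 𝔼)) = x} := by
    refine IsTightMeasureSet.prodMk
      ((isTightMeasureSet_singleton (μ := μ)).subset ?_)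
      ((isTightMeasureSet_singleton (μ := ν)).subset ?_)
    · rintro _ ⟨_, ⟨π, hπ, rfl⟩, rfl⟩
      exact hπ.1
    · rintro _ ⟨_, ⟨π, hπ, rfl⟩, rfl⟩
      exact hπ.2
  have hcompact : IsCompact C := by
    have := isCompact_closure_of_isTightMeasureSet htight
    rwa [hclosed.closure_eq] at this
  have hne : C.Nonempty := by
    refine ⟨⟨μ.prod ν, inferInstance⟩, ?_, ?_⟩
    · simp
    · simp
  have hlsc := lowerSemicontinuous_lintegral_probabilityMeasure (X := 𝔼 × 𝔼)
    (f := fun p => ‖p.1 - p.2‖ₑ ^ 2)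
    ((ENNReal.continuous_pow 2).comp (by fun_prop)) (fun p => by simp)
  obtain ⟨π, hπ, hmin⟩ := LowerSemicontinuousOn.exists_isMinOn hne hcompact
    (hlsc.lowerSemicontinuousOn C)
  refine ⟨π, hπ, le_antisymm (le_iInf₂ fun ρ hρ => ?_) (iInf₂_le (π : Measure (𝔼 × 𝔼)) hπ)⟩
  have := isProbabilityMeasure_of_mem_couplings hρ
  exact hmin (a := ⟨ρ, this⟩) hρ

end OptimalCoupling

/-! ### Legendre transforms and the dual potential -/

section Legendre

variable {d : ℕ}

local notation "𝔼" => EuclideanSpace ℝ (Fin d)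

/-- An upper semicontinuous function that is almost everywhere equal to a continuous one has the
same Legendre transform. -/
lemma legendre_eq_of_ae_eq {g : 𝔼 → EReal} {G : 𝔼 → ℝ} (hG : Continuous G)
    (hg : UpperSemicontinuous g) (h : ∀ᵐ x, g x = G x) :
    legendre g = legendre fun x => (G x : EReal) := by
  have hd : Dense {x | g x = G x} := Measure.dense_of_ae h
  funext y
  refine le_antisymm (iSup_le fun x => ?_) (iSup_le fun x => ?_)
  · refine le_trans ?_ (le_iSup _ x)
    -- Upper semicontinuity forces `G ≤ g` everywhere: a strict drop of `g` below `G` at `x` would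
    -- persist near `x` and meet the dense set of agreement.
    refine EReal.sub_le_sub le_rfl ?_
    by_contra hlt
    obtain ⟨r, hr1, hr2⟩ := EReal.lt_iff_exists_real_btwn.1 (not_le.1 hlt)
    have h1 : ∀ᶠ z in 𝓝 x, g z < r := hg x r hr1
    have h2 : ∀ᶠ z in 𝓝 x, r < G z :=
      hG.continuousAt.eventually (lt_mem_nhds (EReal.coe_lt_coe_iff.1 hr2))
    obtain ⟨z, hz, hz1, hz2⟩ := hd.inter_nhds_nonempty (h1.and h2)
    rw [show g z = G z from hz] at hz1
    exact absurd (EReal.coe_lt_coe_iff.1 hz1) (not_lt.2 hz2.le)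
  · by_contra hlt
    have hc : Continuous fun x : 𝔼 => ((inner ℝ x y - G x : ℝ) : EReal) :=
      continuous_coe_real_ereal.comp (by fun_prop)
    have h1 : ∀ᶠ z in 𝓝 x, legendre g y < ((inner ℝ z y - G z : ℝ) : EReal) := by
      refine hc.continuousAt.eventually (lt_mem_nhds ?_)
      simp only [EReal.coe_sub]
      exact not_le.1 hlt
    obtain ⟨z, hz, hz1⟩ := hd.inter_nhds_nonempty h1
    refine absurd (show legendre g y < ((inner ℝ z y - G z : ℝ) : EReal) from hz1) (not_lt.2 ?_)
    rw [EReal.coe_sub, ← (show g z = G z from hz)]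
    exact le_iSup (fun x => ((inner ℝ x y : ℝ) : EReal) - g x) z

lemma inner_sub_le_of_legendre {G : 𝔼 → ℝ} {y : 𝔼}
    (h : legendre (fun x => (G x : EReal)) y ≠ ⊤) (x : 𝔼) :
    inner ℝ x y - G x ≤ (legendre (fun x => (G x : EReal)) y).toReal := by
  have h1 : ((inner ℝ x y - G x : ℝ) : EReal) ≤ legendre (fun x => (G x : EReal)) y := by
    rw [EReal.coe_sub]
    exact le_iSup (fun x => ((inner ℝ x y : ℝ) : EReal) - (G x : EReal)) x
  have h2 : legendre (fun x => (G x : EReal)) y ≠ ⊥ := by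
    intro hb
    rw [hb] at h1
    exact EReal.coe_ne_bot _ (le_bot_iff.1 h1)
  rw [← EReal.coe_le_coe_iff, EReal.coe_toReal h h2]
  exact h1

/-- Equality in the Fenchel–Young inequality at a point of differentiability determines the
gradient. -/
lemma eq_extGradient_of_legendre_eq {G : 𝔼 → ℝ} {x y : 𝔼}
    (hy : ExtDifferentiableAt (legendre fun x => (G x : EReal)) y)
    (hxy : (legendre (fun x => (G x : EReal)) y).toReal = inner ℝ x y - G x) :
    x = extGradient (legendre fun x => (G x : EReal)) y := by
  set φ := legendre fun x => (G x : EReal) with hφ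
  have hgrad := hy.2.hasGradientAt
  -- By Fenchel–Young this difference is at least `-G x` near `y`, with equality at `y`.
  have hmin : IsLocalMin (fun z => (φ z).toReal - inner ℝ x z) y := by
    filter_upwards [hy.1] with z hz
    have := inner_sub_le_of_legendre hz.1 x
    simp only [hxy]
    linarith
  have hd : HasFDerivAt (fun z => (φ z).toReal - inner ℝ x z)
      (InnerProductSpace.toDual ℝ 𝔼 (extGradient φ y) - innerSL ℝ x) y :=
    (hasGradientAt_iff_hasFDerivAt.1 hgrad).sub (innerSL ℝ x).hasFDerivAt
  have h0 := hmin.hasFDerivAt_eq_zero hd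
  have h1 := congrArg (fun L => L (x - extGradient φ y)) h0
  have h2 : inner ℝ (extGradient φ y - x) (x - extGradient φ y) = 0 := by
    rw [inner_sub_left]
    simpa using h1
  rw [← neg_sub x, inner_neg_left, neg_eq_zero, inner_self_eq_zero, sub_eq_zero] at h2
  exact h2

/-- At a point of differentiability the supremum in the Legendre transform of a continuous function
is attained. -/
lemma exists_legendre_eq {G : 𝔼 → ℝ} (hG : Continuous G) {y : 𝔼}
    (hy : ExtDifferentiableAt (legendre fun x => (G x : EReal)) y) :
    ∃ x, (legendre (fun x => (G x : EReal)) y).toReal = inner ℝ x y - G x := by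
  set φ := legendre fun x => (G x : EReal) with hφ
  obtain ⟨r, hr, hball⟩ : ∃ r > 0, ∀ z, ‖z - y‖ ≤ r →
      φ z ≠ ⊤ ∧ (φ z).toReal ≤ (φ y).toReal + 1 := by
    have h1 : ∀ᶠ z in 𝓝 y, (φ z).toReal < (φ y).toReal + 1 :=
      hy.2.continuousAt.eventually (gt_mem_nhds (lt_add_one _))
    obtain ⟨r, hr, h⟩ := Metric.eventually_nhds_iff.1 (hy.1.and h1)
    refine ⟨r / 2, by positivity, fun z hz => ?_⟩
    have := h (y := z) (by rw [dist_eq_norm]; linarith)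
    exact ⟨this.1.1, this.2.le⟩
  -- Fenchel–Young at `z = y + r x/‖x‖`, where `φ` is bounded by `φ y + 1`, gains `r * ‖x‖`. At `x =
  -- 0` the division by zero gives `z = y`, which is harmless.
  have hcoer : ∀ x, r * ‖x‖ - (φ y).toReal - 1 ≤ G x - inner ℝ x y := by
    intro x
    set z := y + (r / ‖x‖) • x with hz
    have hzr : ‖z - y‖ ≤ r := by
      rw [hz, add_sub_cancel_left, norm_smul, Real.norm_eq_abs, abs_of_nonneg (by positivity)]
      rcases eq_or_ne ‖x‖ 0 with h | h
      · rw [h]; simp [hr.le]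
      · rw [div_mul_cancel₀ _ h]
    obtain ⟨h1, h2⟩ := hball z hzr
    have h3 := inner_sub_le_of_legendre h1 x
    have h4 : inner ℝ x z = inner ℝ x y + r * ‖x‖ := by
      rw [hz, inner_add_right, inner_smul_right, real_inner_self_eq_norm_sq]
      rcases eq_or_ne ‖x‖ 0 with h | h
      · rw [h]; simp
      · field_simp
    linarith
  have hlim : Tendsto (fun x => G x - inner ℝ x y) (cocompact 𝔼) atTop := by
    refine tendsto_atTop_mono hcoer ?_
    simp only [sub_eq_add_neg]
    exact tendsto_atTop_add_const_right _ _ (tendsto_atTop_add_const_right _ _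
      (tendsto_norm_cocompact_atTop.const_mul_atTop hr))
  obtain ⟨x, hx⟩ := Continuous.exists_forall_le (f := fun x => G x - inner ℝ x y)
    (by fun_prop) hlim
  refine ⟨x, ?_⟩
  have h1 : φ y = ((inner ℝ x y - G x : ℝ) : EReal) := by
    refine le_antisymm (iSup_le fun z => ?_) ?_
    · rw [← EReal.coe_sub, EReal.coe_le_coe_iff]
      have := hx z
      linarith
    · rw [EReal.coe_sub]
      exact le_iSup (fun x => ((inner ℝ x y : ℝ) : EReal) - (G x : EReal)) x
  rw [h1, EReal.toReal_coe]

lemma exists_affine_le {f : 𝔼 → ℝ} (hf : ConvexOn ℝ Set.univ f) :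
    ∃ (l : 𝔼 →L[ℝ] ℝ) (c : ℝ), ∀ x, l x + c ≤ f x := by
  obtain ⟨l, c, h, -⟩ := hf.exists_affine_le_of_lt (𝕜 := ℝ) (x := 0) (a := f 0 - 1)
    (Set.mem_univ _) (by simp) isClosed_univ
    (hf.locallyLipschitz.continuous.lowerSemicontinuous.lowerSemicontinuousOn _)
  exact ⟨l, c, fun x => h ⟨x, Set.mem_univ x⟩⟩

/-- A convex expansion whose gradient is defined almost everywhere yields a convex function of
quadratic growth that touches the quadratic cost along the graph of the gradient. -/
lemma IsConvexExpansion.exists_potential {φ : 𝔼 → EReal} (hφ : IsConvexExpansion φ)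
    {ν : Measure 𝔼} [IsProbabilityMeasure ν] (hd : ∀ᵐ y ∂ν, ExtDifferentiableAt φ y) :
    ∃ H : 𝔼 → ℝ, ConvexOn ℝ Set.univ H ∧ (∃ C, ∀ x, |H x| ≤ C * (1 + ‖x‖ ^ 2)) ∧
      ∀ᵐ y ∂ν, ∀ x,
        H x - H (extGradient φ y) ≤ ‖x - y‖ ^ 2 / 2 - ‖extGradient φ y - y‖ ^ 2 / 2 ∧
        (‖x - y‖ ^ 2 / 2 - ‖extGradient φ y - y‖ ^ 2 / 2 ≤ H x - H (extGradient φ y) →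
          x = extGradient φ y) := by
  obtain ⟨-, -, -, g, hgp, hgu, ⟨hgf, hgl, hgH⟩, rfl⟩ := hφ
  obtain ⟨H, hH, hgeq⟩ := exists_convexOn_ae_eq_of_hessian_le hgl hgH
  have hHc : Continuous H := hH.locallyLipschitz.continuous
  set G : 𝔼 → ℝ := fun x => ‖x‖ ^ 2 / 2 - H x with hG
  have hGc : Continuous G := by fun_prop
  have hlg : legendre g = legendre fun x => (G x : EReal) := by
    refine legendre_eq_of_ae_eq hGc hgu ?_
    filter_upwards [hgf, hgeq] with x h1 h2
    rw [← EReal.coe_toReal h1.1 h1.2, h2]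
  rw [hlg] at hd ⊢
  set φ := legendre fun x => (G x : EReal) with hφ
  have hcost : ∀ x y : 𝔼, ‖x - y‖ ^ 2 / 2 = ‖x‖ ^ 2 / 2 - inner ℝ x y + ‖y‖ ^ 2 / 2 := by
    intro x y; rw [norm_sub_sq_real]; ring
  refine ⟨H, hH, ?_, ?_⟩
  · obtain ⟨y, hy⟩ := hd.exists
    obtain ⟨l, c, hl⟩ := exists_affine_le hH
    -- The upper bound on `H` is Fenchel–Young at a single `y` with `φ y` finite; the lower bound is
    -- an affine minorant.
    refine ⟨1 + ‖y‖ ^ 2 + |(φ y).toReal| + ‖l‖ + |c|, fun x => ?_⟩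
    have h1 := inner_sub_le_of_legendre hy.1.self_of_nhds.1 x
    have h2 := hl x
    have h3 : |l x| ≤ ‖l‖ * ‖x‖ := l.le_opNorm x
    have h4 := abs_le.1 (abs_real_inner_le_norm x y)
    have h5 := abs_le.1 h3
    have h6 : ‖x‖ ≤ 1 + ‖x‖ ^ 2 := by nlinarith [sq_nonneg (‖x‖ - 1)]
    have h7 : ‖l‖ * ‖x‖ ≤ ‖l‖ * (1 + ‖x‖ ^ 2) := mul_le_mul_of_nonneg_left h6 (norm_nonneg _)
    have h8 : ‖x‖ * ‖y‖ ≤ ‖x‖ ^ 2 / 2 + ‖y‖ ^ 2 / 2 := by nlinarith [sq_nonneg (‖x‖ - ‖y‖)]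
    have h9 : ∀ a : ℝ, |a| ≤ |a| * (1 + ‖x‖ ^ 2) := fun a => by
      nlinarith [abs_nonneg a, sq_nonneg ‖x‖, mul_nonneg (abs_nonneg a) (sq_nonneg ‖x‖)]
    have h10 := h9 c
    have h11 := h9 (φ y).toReal
    have h13 : 0 ≤ ‖l‖ * (1 + ‖x‖ ^ 2) := by positivity
    have h14 := neg_abs_le c
    have h16 : (φ y).toReal ≤ |(φ y).toReal| := le_abs_self _
    have e1 : G x = ‖x‖ ^ 2 / 2 - H x := rfl
    rw [abs_le]
    constructor
    · nlinarith [abs_nonneg c, abs_nonneg (φ y).toReal, sq_nonneg ‖x‖, sq_nonneg ‖y‖]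
    · nlinarith [abs_nonneg c, abs_nonneg (φ y).toReal, sq_nonneg ‖x‖, sq_nonneg ‖y‖]
  · filter_upwards [hd] with y hy x
    obtain ⟨x₀, hx₀⟩ := exists_legendre_eq hGc hy
    obtain rfl := eq_extGradient_of_legendre_eq hy hx₀
    have h1 := inner_sub_le_of_legendre hy.1.self_of_nhds.1 x
    rw [hx₀] at h1
    rw [hcost, hcost]
    have e1 : G x = ‖x‖ ^ 2 / 2 - H x := rfl
    have e2 : G (extGradient φ y) = ‖extGradient φ y‖ ^ 2 / 2 - H (extGradient φ y) := rfl
    refine ⟨by linarith, fun h => eq_extGradient_of_legendre_eq hy ?_⟩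
    rw [hx₀]
    linarith

end Legendre

/-! ### Second moments, and the potential as a certificate of unique projection -/

section Moments

variable {d : ℕ}

local notation "𝔼" => EuclideanSpace ℝ (Fin d)

lemma memLp_id_of_mem_P2 {μ : Measure 𝔼} (hμ : μ ∈ P2 d) : MemLp id 2 μ := by
  refine ⟨aestronglyMeasurable_id, ?_⟩
  rw [eLpNorm_lt_top_iff_lintegral_rpow_enorm_lt_top (by norm_num) (by norm_num)]
  simpa using hμ.2

lemma mem_P2_of_map {Ω : Type*} [MeasurableSpace Ω] {P : Measure Ω} [IsProbabilityMeasure P]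
    {X : Ω → 𝔼} (hX : Measurable X) (h2 : MemLp X 2 P) : P.map X ∈ P2 d := by
  refine ⟨Measure.isProbabilityMeasure_map hX.aemeasurable, ?_⟩
  rw [lintegral_map (by fun_prop) hX]
  have := (eLpNorm_lt_top_iff_lintegral_rpow_enorm_lt_top (by norm_num) (by norm_num)).1 h2.2
  simpa using this

lemma lintegral_enorm_sq_eq {Ω : Type*} [MeasurableSpace Ω] {P : Measure Ω} {X : Ω → 𝔼}
    (h2 : MemLp X 2 P) : ∫⁻ w, ‖X w‖ₑ ^ 2 ∂P = ENNReal.ofReal (∫ w, ‖X w‖ ^ 2 ∂P) := by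
  rw [ofReal_integral_eq_lintegral_ofReal (h2.integrable_norm_pow (by norm_num))
    (Eventually.of_forall fun w => by positivity)]
  refine lintegral_congr fun w => ?_
  rw [ENNReal.ofReal_pow (norm_nonneg _), ofReal_norm]

lemma integrable_of_quadratic_growth {Ω : Type*} [MeasurableSpace Ω] {P : Measure Ω}
    [IsFiniteMeasure P] {X : Ω → 𝔼} (h2 : MemLp X 2 P) {f : 𝔼 → ℝ} (hf : Continuous f) {C : ℝ}
    (hC : ∀ x, |f x| ≤ C * (1 + ‖x‖ ^ 2)) : Integrable (fun w => f (X w)) P := by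
  refine Integrable.mono' (g := fun w => C * (1 + ‖X w‖ ^ 2)) ?_
    (hf.comp_aestronglyMeasurable h2.1) (Eventually.of_forall fun w => hC _)
  exact ((integrable_const 1).add (h2.integrable_norm_pow (by norm_num))).const_mul C

lemma extIntegral_of_integrable {μ : Measure 𝔼} {f : 𝔼 → ℝ} (hf : Integrable f μ) :
    extIntegral μ f = ((∫ x, f x ∂μ : ℝ) : EReal) := by
  rw [integral_eq_lintegral_pos_part_sub_lintegral_neg_part hf, EReal.coe_sub, extIntegral]
  have h1 : ∫⁻ x, ENNReal.ofReal (f x) ∂μ ≠ ⊤ := hf.lintegral_lt_top.ne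
  have h2 : ∫⁻ x, ENNReal.ofReal (-f x) ∂μ ≠ ⊤ := hf.neg.lintegral_lt_top.ne
  rw [EReal.coe_ennreal_toReal h1, EReal.coe_ennreal_toReal h2]

lemma ConvexOrder.integral_le {μ ξ : Measure 𝔼} (h : ConvexOrder μ ξ) {f : 𝔼 → ℝ}
    (hf : ConvexOn ℝ Set.univ f) (hμ : Integrable f μ) (hξ : Integrable f ξ) :
    ∫ x, f x ∂μ ≤ ∫ x, f x ∂ξ := by
  have := h f hf ⟨hμ.1.aemeasurable, Or.inl hμ.lintegral_lt_top.ne⟩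
    ⟨hξ.1.aemeasurable, Or.inl hξ.lintegral_lt_top.ne⟩
  rwa [extIntegral_of_integrable hμ, extIntegral_of_integrable hξ, EReal.coe_le_coe_iff] at this

lemma ConvexOrder.refl (μ : Measure 𝔼) : ConvexOrder μ μ := fun _ _ _ _ => le_rfl

lemma memLp_fst_of_mem_couplings {μ ν : Measure 𝔼} (hμ : μ ∈ P2 d) {π : Measure (𝔼 × 𝔼)}
    (hπ : π ∈ couplings μ ν) : MemLp Prod.fst 2 π := by
  have := memLp_id_of_mem_P2 hμ
  rw [← hπ.1] at this
  exact (memLp_map_measure_iff aestronglyMeasurable_id measurable_fst.aemeasurable).1 this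

lemma memLp_snd_of_mem_couplings {μ ν : Measure 𝔼} (hν : ν ∈ P2 d) {π : Measure (𝔼 × 𝔼)}
    (hπ : π ∈ couplings μ ν) : MemLp Prod.snd 2 π := by
  have := memLp_id_of_mem_P2 hν
  rw [← hπ.2] at this
  exact (memLp_map_measure_iff aestronglyMeasurable_id measurable_snd.aemeasurable).1 this

/-- A convex potential touching the quadratic cost along the graph of `T` certifies that the image
of `ν` under `T` is the unique projection. -/
lemma forwardProjections_eq_singleton_of_potential {μ ν : Measure 𝔼} (hμ : μ ∈ P2 d)
    (hν : ν ∈ P2 d) {T : 𝔼 → 𝔼} (hT : Measurable T) (hTν : ν.map T = μ) {H : 𝔼 → ℝ}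
    (hH : ConvexOn ℝ Set.univ H) {C : ℝ} (hC : ∀ x, |H x| ≤ C * (1 + ‖x‖ ^ 2))
    (hpot : ∀ᵐ y ∂ν, ∀ x, H x - H (T y) ≤ ‖x - y‖ ^ 2 / 2 - ‖T y - y‖ ^ 2 / 2 ∧
        (‖x - y‖ ^ 2 / 2 - ‖T y - y‖ ^ 2 / 2 ≤ H x - H (T y) → x = T y)) :
    forwardProjections μ ν = {μ} := by
  have := hμ.1
  have := hν.1
  have hHc : Continuous H := hH.locallyLipschitz.continuous
  have hint : ∀ {η : Measure 𝔼}, η ∈ P2 d → Integrable H η := fun {η} hη => by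
    have := hη.1
    exact integrable_of_quadratic_growth (memLp_id_of_mem_P2 hη) hHc hC
  have hν2 : MemLp (fun y => y) 2 ν := memLp_id_of_mem_P2 hν
  have hT2 : MemLp T 2 ν := by
    have := memLp_id_of_mem_P2 hμ
    rw [← hTν] at this
    exact (memLp_map_measure_iff aestronglyMeasurable_id hT.aemeasurable).1 this
  set c₀ : ℝ := ∫ y, ‖T y - y‖ ^ 2 ∂ν with hc₀
  have hHT : Integrable (fun y => H (T y)) ν := integrable_of_quadratic_growth hT2 hHc hC
  have hTsq : Integrable (fun y => ‖T y - y‖ ^ 2) ν :=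
    (hT2.sub hν2).integrable_norm_pow (by norm_num)
  have hHTμ : ∫ y, H (T y) ∂ν = ∫ x, H x ∂μ := by
    rw [← hTν, integral_map hT.aemeasurable hHc.aestronglyMeasurable]
  have key : ∀ η ∈ forwardCone μ, ∀ π ∈ couplings η ν,
      Integrable (fun p : 𝔼 × 𝔼 => ‖p.1 - p.2‖ ^ 2) π ∧
      ∫⁻ p, ‖p.1 - p.2‖ₑ ^ 2 ∂π = ENNReal.ofReal (∫ p, ‖p.1 - p.2‖ ^ 2 ∂π) ∧
      c₀ ≤ ∫ p, ‖p.1 - p.2‖ ^ 2 ∂π ∧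
      (∫ p, ‖p.1 - p.2‖ ^ 2 ∂π ≤ c₀ → η = μ) := by
    intro η hη π hπ
    have hm1 : MemLp Prod.fst 2 π := memLp_fst_of_mem_couplings hη.1 hπ
    have hm2 : MemLp Prod.snd 2 π := memLp_snd_of_mem_couplings hν hπ
    have hm : MemLp (fun p : 𝔼 × 𝔼 => p.1 - p.2) 2 π := hm1.sub hm2
    have hI : Integrable (fun p : 𝔼 × 𝔼 => ‖p.1 - p.2‖ ^ 2) π :=
      hm.integrable_norm_pow (by norm_num)
    have hHη := hint hη.1
    have hle := hη.2.integral_le hH (hint hμ) hHη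
    have e1 : ∫ p : 𝔼 × 𝔼, H p.1 ∂π = ∫ x, H x ∂η := by
      rw [← hπ.1, integral_map measurable_fst.aemeasurable hHc.aestronglyMeasurable]
    have i1 : Integrable (fun p : 𝔼 × 𝔼 => H p.1) π := by
      rw [← hπ.1] at hHη
      exact hHη.comp_measurable measurable_fst
    set a : 𝔼 → ℝ := fun y => ‖T y - y‖ ^ 2 / 2 - H (T y) with ha
    have iaν : Integrable a ν := (hTsq.div_const 2).sub hHT
    have eaν : ∫ y, a y ∂ν = c₀ / 2 - ∫ x, H x ∂μ := by
      rw [ha, integral_sub (hTsq.div_const 2) hHT, integral_div, hHTμ]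
    have e2 : ∫ p : 𝔼 × 𝔼, a p.2 ∂π = ∫ y, a y ∂ν := by
      rw [← hπ.2, integral_map measurable_snd.aemeasurable]
      rw [hπ.2]; exact iaν.1
    have i2 : Integrable (fun p : 𝔼 × 𝔼 => a p.2) π := by
      have := iaν
      rw [← hπ.2] at this
      exact this.comp_measurable measurable_snd
    have hae : ∀ᵐ p ∂π, ∀ x, H x - H (T p.2) ≤ ‖x - p.2‖ ^ 2 / 2 - ‖T p.2 - p.2‖ ^ 2 / 2 ∧
        (‖x - p.2‖ ^ 2 / 2 - ‖T p.2 - p.2‖ ^ 2 / 2 ≤ H x - H (T p.2) → x = T p.2) := by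
      rw [← hπ.2] at hpot
      exact ae_of_ae_map measurable_snd.aemeasurable hpot
    -- The duality slack: nonnegative, zero only where `p.1 = T p.2`, and with integral half the
    -- excess cost over `c₀` minus `∫ H dη - ∫ H dμ`.
    set F : 𝔼 × 𝔼 → ℝ := fun p => ‖p.1 - p.2‖ ^ 2 / 2 - H p.1 - a p.2 with hF
    have iF : Integrable F π := ((hI.div_const 2).sub i1).sub i2
    have eF : ∫ p, F p ∂π
        = (∫ p, ‖p.1 - p.2‖ ^ 2 ∂π) / 2 - ∫ x, H x ∂η - (c₀ / 2 - ∫ x, H x ∂μ) := by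
      have h1 : ∫ p, F p ∂π
          = ∫ p : 𝔼 × 𝔼, (‖p.1 - p.2‖ ^ 2 / 2 - H p.1) ∂π - ∫ p : 𝔼 × 𝔼, a p.2 ∂π :=
        integral_sub ((hI.div_const 2).sub i1) i2
      rw [h1, integral_sub (hI.div_const 2) i1, integral_div, e1, e2, eaν]
    have hF0 : 0 ≤ᵐ[π] F := by
      filter_upwards [hae] with p hp
      have := (hp p.1).1
      simp only [hF, ha, Pi.zero_apply]
      linarith
    have hFi := integral_nonneg_of_ae hF0
    refine ⟨hI, lintegral_enorm_sq_eq hm, by linarith, fun hc => ?_⟩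
    have hz : ∫ p, F p ∂π = 0 := le_antisymm (by linarith) hFi
    have hz' := (integral_eq_zero_iff_of_nonneg_ae hF0 iF).1 hz
    have hx : ∀ᵐ p ∂π, p.1 = T p.2 := by
      filter_upwards [hae, hz'] with p hp hp0
      refine (hp p.1).2 ?_
      simp only [hF, ha, Pi.zero_apply] at hp0
      linarith
    rw [← hπ.1, Measure.map_congr (g := T ∘ Prod.snd) hx, ← Measure.map_map hT measurable_snd,
      hπ.2, hTν]
  have hμcone : μ ∈ forwardCone μ := ⟨hμ, ConvexOrder.refl μ⟩
  have hupper : transportCost μ ν ≤ ENNReal.ofReal c₀ := by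
    have hg : Measurable fun y => (T y, y) := hT.prodMk measurable_id
    refine (iInf₂_le (ν.map fun y => (T y, y)) ?_).trans ?_
    · constructor
      · rw [Measure.map_map measurable_fst hg]; exact hTν
      · rw [Measure.map_map measurable_snd hg]; exact Measure.map_id
    · rw [lintegral_map (by fun_prop) hg, hc₀]
      exact (lintegral_enorm_sq_eq (X := fun y => T y - y) (hT2.sub hν2)).le
  have hlower : ∀ η ∈ forwardCone μ, ENNReal.ofReal c₀ ≤ transportCost η ν := by
    intro η hη
    refine le_iInf₂ fun π hπ => ?_
    obtain ⟨-, h2, h3, -⟩ := key η hη π hπ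
    rw [h2]
    exact ENNReal.ofReal_le_ofReal h3
  have hinf : ⨅ η ∈ forwardCone μ, transportCost η ν = ENNReal.ofReal c₀ :=
    le_antisymm ((iInf₂_le μ hμcone).trans hupper) (le_iInf₂ hlower)
  refine Set.eq_singleton_iff_unique_mem.2 ⟨⟨hμcone, ?_⟩, fun η hη => ?_⟩
  · rw [hinf]; exact le_antisymm hupper (hlower μ hμcone)
  · obtain ⟨hηc, hηe⟩ := hη
    have := hηc.1.1
    -- The equality case concerns one coupling, so attainment of the cost is needed here.
    obtain ⟨π, hπ, hπe⟩ := exists_optimal_coupling η ν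
    obtain ⟨-, h2, h3, h4⟩ := key η hηc π hπ
    refine h4 ?_
    rw [hinf, ← hπe, h2] at hηe
    refine (ENNReal.ofReal_le_ofReal_iff ?_).1 hηe.le
    exact integral_nonneg fun y => by positivity

lemma measurable_extGradient (φ : 𝔼 → EReal) : Measurable (extGradient φ) :=
  (InnerProductSpace.toDual ℝ 𝔼).symm.continuous.measurable.comp (measurable_fderiv ℝ _)

lemma forwardProjections_eq_singleton_of_gradient {μ ν : Measure 𝔼} (hμ : μ ∈ P2 d)
    (hν : ν ∈ P2 d) {φ : 𝔼 → EReal} (hφ : IsConvexExpansion φ)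
    (h : GradientPushesForward φ ν μ) : forwardProjections μ ν = {μ} := by
  have := hν.1
  obtain ⟨H, hH, ⟨C, hC⟩, hpot⟩ := hφ.exists_potential h.1
  exact forwardProjections_eq_singleton_of_potential hμ hν (measurable_extGradient φ) h.2 hH hC hpot

end Moments

/-! ### First variation by splitting mass -/

section Variation

variable {d : ℕ}

local notation "𝔼" => EuclideanSpace ℝ (Fin d)

lemma integrable_inner_of_memLp_two {Ω : Type*} [MeasurableSpace Ω] {P : Measure Ω}
    {X Y : Ω → 𝔼} (hX : MemLp X 2 P) (hY : MemLp Y 2 P) :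
    Integrable (fun w => inner ℝ (X w) (Y w) : Ω → ℝ) P := by
  refine Integrable.mono' ((hX.integrable_norm_pow (by norm_num)).add
    (hY.integrable_norm_pow (by norm_num))) (hX.1.inner hY.1) (Eventually.of_forall fun w => ?_)
  have h1 := abs_real_inner_le_norm (X w) (Y w)
  simp only [Pi.add_apply, Real.norm_eq_abs]
  nlinarith [sq_nonneg (‖X w‖ - ‖Y w‖), sq_nonneg (‖X w‖ + ‖Y w‖)]

lemma abs_le_quadratic_of_affine (l : 𝔼 →L[ℝ] ℝ) (c : ℝ) (x : 𝔼) :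
    |l x + c| ≤ (‖l‖ + |c|) * (1 + ‖x‖ ^ 2) := by
  have h3 : |l x| ≤ ‖l‖ * ‖x‖ := l.le_opNorm x
  have h6 : ‖x‖ ≤ 1 + ‖x‖ ^ 2 := by nlinarith [sq_nonneg (‖x‖ - 1)]
  have h7 : ‖l‖ * ‖x‖ ≤ ‖l‖ * (1 + ‖x‖ ^ 2) := mul_le_mul_of_nonneg_left h6 (norm_nonneg _)
  have h8 : 0 ≤ |c| * ‖x‖ ^ 2 := by positivity
  linarith [abs_add_le (l x) c]

lemma mixture_map_mem_P2 {Ω : Type*} [MeasurableSpace Ω] {P : Measure Ω}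
    [IsProbabilityMeasure P] {Z W : Ω → 𝔼} (hZ : Measurable Z) (hW : Measurable W)
    (hZ2 : MemLp Z 2 P) (hW2 : MemLp W 2 P) {a b : ℝ} (ha : 0 < a) (hb : 0 < b)
    (hab : a + b = 1) :
    ENNReal.ofReal a • P.map Z + ENNReal.ofReal b • P.map W ∈ P2 d := by
  have h1 := mem_P2_of_map hZ hZ2
  have h2 := mem_P2_of_map hW hW2
  have := h1.1
  have := h2.1
  refine ⟨⟨?_⟩, ?_⟩
  · simp [← ENNReal.ofReal_add ha.le hb.le, hab]
  · rw [lintegral_add_measure, lintegral_smul_measure, lintegral_smul_measure]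
    exact ENNReal.add_lt_top.2 ⟨ENNReal.mul_lt_top ENNReal.ofReal_lt_top h1.2,
      ENNReal.mul_lt_top ENNReal.ofReal_lt_top h2.2⟩

/-- Splitting a random vector into two values with the right barycentre increases its law in convex
order. -/
lemma convexOrder_map_of_barycenter {Ω : Type*} [MeasurableSpace Ω] {P : Measure Ω}
    [IsProbabilityMeasure P] {X Z W : Ω → 𝔼} (hX : Measurable X) (hZ : Measurable Z)
    (hW : Measurable W) (hX2 : MemLp X 2 P) (hZ2 : MemLp Z 2 P) (hW2 : MemLp W 2 P) {a b : ℝ}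
    (ha : 0 < a) (hb : 0 < b) (hab : a + b = 1) (hXZW : ∀ w, X w = a • Z w + b • W w) :
    ConvexOrder (P.map X) (ENNReal.ofReal a • P.map Z + ENNReal.ofReal b • P.map W) := by
  intro f hf hfX hfξ
  set ξ := ENNReal.ofReal a • P.map Z + ENNReal.ofReal b • P.map W with hξ
  have hξ2 : ξ ∈ P2 d := mixture_map_mem_P2 hZ hW hZ2 hW2 ha hb hab
  have := hξ2.1
  have hfc : Continuous f := hf.locallyLipschitz.continuous
  obtain ⟨l, c, hl⟩ := exists_affine_le hf
  have hlc : Continuous fun x => l x + c := by fun_prop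
  by_cases hfi : Integrable f ξ
  · have h1 : Integrable f (ENNReal.ofReal a • P.map Z) := (integrable_add_measure.1 hfi).1
    have h2 : Integrable f (ENNReal.ofReal b • P.map W) := (integrable_add_measure.1 hfi).2
    have ha' : ENNReal.ofReal a ≠ 0 := by simpa using ha
    have hb' : ENNReal.ofReal b ≠ 0 := by simpa using hb
    have h3 : Integrable (fun w => f (Z w)) P :=
      ((integrable_smul_measure ha' ENNReal.ofReal_ne_top).1 h1).comp_measurable hZ
    have h4 : Integrable (fun w => f (W w)) P :=
      ((integrable_smul_measure hb' ENNReal.ofReal_ne_top).1 h2).comp_measurable hW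
    have h5 : Integrable (fun w => a * f (Z w) + b * f (W w)) P :=
      (h3.const_mul a).add (h4.const_mul b)
    have hle : ∀ w, f (X w) ≤ a * f (Z w) + b * f (W w) := by
      intro w
      rw [hXZW]
      exact hf.2 (Set.mem_univ _) (Set.mem_univ _) ha.le hb.le hab
    have h6 : Integrable (fun w => l (X w) + c) P :=
      integrable_of_quadratic_growth hX2 hlc (abs_le_quadratic_of_affine l c)
    have h7 : Integrable (fun w => f (X w)) P := by
      refine Integrable.mono' (h5.abs.add h6.abs) (hfc.measurable.comp hX).aestronglyMeasurable
        (Eventually.of_forall fun w => ?_)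
      have := hle w
      have := hl (X w)
      simp only [Pi.add_apply, Real.norm_eq_abs]
      rw [abs_le]
      constructor
      · have := neg_abs_le (l (X w) + c)
        have := abs_nonneg (a * f (Z w) + b * f (W w))
        linarith
      · have := le_abs_self (a * f (Z w) + b * f (W w))
        have := abs_nonneg (l (X w) + c)
        linarith
    have h8 : Integrable f (P.map X) :=
      (integrable_map_measure hfc.aestronglyMeasurable hX.aemeasurable).2 h7
    rw [extIntegral_of_integrable h8, extIntegral_of_integrable hfi, EReal.coe_le_coe_iff,
      integral_add_measure h1 h2, integral_smul_measure, integral_smul_measure,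
      integral_map hX.aemeasurable hfc.aestronglyMeasurable,
      integral_map hZ.aemeasurable hfc.aestronglyMeasurable,
      integral_map hW.aemeasurable hfc.aestronglyMeasurable, ENNReal.toReal_ofReal ha.le,
      ENNReal.toReal_ofReal hb.le, smul_eq_mul, smul_eq_mul, ← integral_const_mul,
      ← integral_const_mul, ← integral_add (h3.const_mul a) (h4.const_mul b)]
    exact integral_mono h7 h5 hle
  -- The affine minorant makes the negative part integrable, so a non-integrable `f` has extended
  -- integral `⊤` under `ξ`.
  · have hneg : ∫⁻ x, ENNReal.ofReal (-f x) ∂ξ ≠ ⊤ := by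
      have h6 : Integrable (fun x => l x + c) ξ :=
        integrable_of_quadratic_growth (memLp_id_of_mem_P2 hξ2) hlc (abs_le_quadratic_of_affine l c)
      refine ne_top_of_le_ne_top h6.neg.lintegral_lt_top.ne (lintegral_mono fun x => ?_)
      exact ENNReal.ofReal_le_ofReal (neg_le_neg (hl x))
    have hpos : ∫⁻ x, ENNReal.ofReal (f x) ∂ξ = ⊤ := by
      by_contra hne
      refine hfi ⟨hfc.aestronglyMeasurable, ?_⟩
      have h9 : ∀ x, ‖f x‖ₑ ≤ ENNReal.ofReal (f x) + ENNReal.ofReal (-f x) := by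
        intro x
        rw [← ofReal_norm, Real.norm_eq_abs]
        rcases le_total 0 (f x) with h | h
        · rw [abs_of_nonneg h]; exact le_self_add
        · rw [abs_of_nonpos h]; exact le_add_self
      refine (lintegral_mono h9).trans_lt ?_
      rw [lintegral_add_left hfc.measurable.ennreal_ofReal]
      exact ENNReal.add_lt_top.2 ⟨lt_top_iff_ne_top.2 hne, lt_top_iff_ne_top.2 hneg⟩
    have : extIntegral ξ f = ⊤ := by
      rw [extIntegral, hpos, ← EReal.coe_ennreal_toReal hneg]
      simp
    rw [this]
    exact le_top

/-- First variation of the transport cost along splittings of the projected measure. -/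
lemma integral_inner_sub_nonpos_of_projection {μ ν : Measure 𝔼} (hμν : μ ∈ forwardProjections μ ν)
    {Ω : Type*} [MeasurableSpace Ω] {P : Measure Ω} [IsProbabilityMeasure P] {X Y Y' : Ω → 𝔼}
    (hX : Measurable X) (hY : Measurable Y) (hY' : Measurable Y') (hX2 : MemLp X 2 P)
    (hY2 : MemLp Y 2 P) (hY'2 : MemLp Y' 2 P) (hXμ : P.map X = μ) (hYν : P.map Y = ν)
    (hY'ν : P.map Y' = ν) (hopt : ∫⁻ w, ‖X w - Y w‖ₑ ^ 2 ∂P = transportCost μ ν) :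
    ∫ w, inner ℝ (X w - Y w) (Y' w - Y w) ∂P ≤ 0 := by
  have hD2 : MemLp (fun w => Y' w - Y w) 2 P := hY'2.sub hY2
  have hP2 : MemLp (fun w => X w - Y w) 2 P := hX2.sub hY2
  have iPD : Integrable (fun w => inner ℝ (X w - Y w) (Y' w - Y w)) P := integrable_inner_of_memLp_two hP2 hD2
  have iPP : Integrable (fun w => ‖X w - Y w‖ ^ 2) P := hP2.integrable_norm_pow (by norm_num)
  have iDD : Integrable (fun w => ‖Y' w - Y w‖ ^ 2) P := hD2.integrable_norm_pow (by norm_num)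
  set A := ∫ w, inner ℝ (X w - Y w) (Y' w - Y w) ∂P with hA
  set B := ∫ w, ‖Y' w - Y w‖ ^ 2 ∂P with hB
  have hB0 : 0 ≤ B := integral_nonneg fun w => by positivity
  have key : ∀ r : ℝ, 0 < r → 2 * A ≤ r * B := by
    intro r hr
    have hr1 : 0 < 1 + r := by linarith
    set a : ℝ := 1 / (1 + r) with ha
    set b : ℝ := r / (1 + r) with hb
    have ha0 : 0 < a := by positivity
    have hb0 : 0 < b := by positivity
    have hab : a + b = 1 := by rw [ha, hb]; field_simp
    have harb : a * r = b := by rw [ha, hb]; field_simp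
    -- `W` is to be coupled with `Y'`, which leaves the displacement `X - Y` unchanged; `Z` stays
    -- with `Y` and balances the barycentre. Only the `Z` part changes the cost, by `-2rA + r²B`.
    set Z : Ω → 𝔼 := fun w => X w - r • (Y' w - Y w) with hZdef
    set W : Ω → 𝔼 := fun w => X w - Y w + Y' w with hWdef
    have hZ : Measurable Z := hX.sub ((hY'.sub hY).const_smul r)
    have hW : Measurable W := (hX.sub hY).add hY'
    have hZ2 : MemLp Z 2 P := hX2.sub (hD2.const_smul r)
    have hW2 : MemLp W 2 P := hP2.add hY'2
    have hbar : ∀ w, X w = a • Z w + b • W w := by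
      intro w
      simp only [hZdef, hWdef, ← harb]
      have : a = 1 - a * r := by rw [harb]; linarith
      have e : a • (X w - r • (Y' w - Y w)) + (a * r) • (X w - Y w + Y' w)
        = (a + a * r) • X w := by module
      rw [e, harb, hab, one_smul]
    set ξ := ENNReal.ofReal a • P.map Z + ENNReal.ofReal b • P.map W with hξ
    have hξc : ξ ∈ forwardCone μ := by
      refine ⟨mixture_map_mem_P2 hZ hW hZ2 hW2 ha0 hb0 hab, ?_⟩
      rw [← hXμ]
      exact convexOrder_map_of_barycenter hX hZ hW hX2 hZ2 hW2 ha0 hb0 hab hbar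
    have h1 : transportCost μ ν ≤ transportCost ξ ν := by
      rw [hμν.2]; exact iInf₂_le ξ hξc
    have hZY : Measurable fun w => (Z w, Y w) := hZ.prodMk hY
    have hWY : Measurable fun w => (W w, Y' w) := hW.prodMk hY'
    have h2 : transportCost ξ ν ≤ ENNReal.ofReal a * ∫⁻ w, ‖Z w - Y w‖ₑ ^ 2 ∂P
        + ENNReal.ofReal b * ∫⁻ w, ‖W w - Y' w‖ₑ ^ 2 ∂P := by
      have hmem : ENNReal.ofReal a • P.map (fun w => (Z w, Y w))
          + ENNReal.ofReal b • P.map (fun w => (W w, Y' w)) ∈ couplings ξ ν := by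
        constructor
        · rw [Measure.map_add _ _ measurable_fst, Measure.map_smul, Measure.map_smul,
            Measure.map_map measurable_fst hZY, Measure.map_map measurable_fst hWY]
          rfl
        · rw [Measure.map_add _ _ measurable_snd, Measure.map_smul, Measure.map_smul,
            Measure.map_map measurable_snd hZY, Measure.map_map measurable_snd hWY]
          change ENNReal.ofReal a • P.map Y + ENNReal.ofReal b • P.map Y' = ν
          rw [hYν, hY'ν, ← add_smul, ← ENNReal.ofReal_add ha0.le hb0.le, hab]
          simp
      refine (iInf₂_le _ hmem).trans ?_
      rw [lintegral_add_measure, lintegral_smul_measure, lintegral_smul_measure,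
        lintegral_map (by fun_prop) hZY, lintegral_map (by fun_prop) hWY]
      rfl
    have hZY2 : MemLp (fun w => Z w - Y w) 2 P := hZ2.sub hY2
    have hWY2 : MemLp (fun w => W w - Y' w) 2 P := hW2.sub hY'2
    have h3 := h1.trans h2
    rw [← hopt, lintegral_enorm_sq_eq hP2, lintegral_enorm_sq_eq hZY2, lintegral_enorm_sq_eq hWY2,
      ← ENNReal.ofReal_mul ha0.le, ← ENNReal.ofReal_mul hb0.le,
      ← ENNReal.ofReal_add (mul_nonneg ha0.le (integral_nonneg fun w => by positivity))
        (mul_nonneg hb0.le (integral_nonneg fun w => by positivity)),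
      ENNReal.ofReal_le_ofReal_iff (add_nonneg
        (mul_nonneg ha0.le (integral_nonneg fun w => by positivity))
        (mul_nonneg hb0.le (integral_nonneg fun w => by positivity)))] at h3
    have e1 : ∫ w, ‖Z w - Y w‖ ^ 2 ∂P
        = ∫ w, ‖X w - Y w‖ ^ 2 ∂P - 2 * r * A + r ^ 2 * B := by
      rw [hA, hB, ← integral_const_mul, ← integral_const_mul,
        ← integral_sub iPP (iPD.const_mul _)]
      refine Eq.trans ?_ (integral_add (iPP.sub (iPD.const_mul (2 * r))) (iDD.const_mul (r ^ 2)))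
      refine integral_congr_ae (Eventually.of_forall fun w => ?_)
      simp only [hZdef]
      rw [show X w - r • (Y' w - Y w) - Y w = (X w - Y w) - r • (Y' w - Y w) by abel,
        norm_sub_sq_real, inner_smul_right, norm_smul, mul_pow, Real.norm_eq_abs, sq_abs]
      ring
    have e2 : ∫ w, ‖W w - Y' w‖ ^ 2 ∂P = ∫ w, ‖X w - Y w‖ ^ 2 ∂P := by
      simp only [hWdef, add_sub_cancel_right]
    rw [e1, e2] at h3
    have h4 : 0 ≤ (a * r) * (r * B - 2 * A) := by
      have h5 : a * ∫ w, ‖X w - Y w‖ ^ 2 ∂P + b * ∫ w, ‖X w - Y w‖ ^ 2 ∂P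
        = ∫ w, ‖X w - Y w‖ ^ 2 ∂P := by rw [← add_mul, hab, one_mul]
      nlinarith [h3, h5]
    have h6 := nonneg_of_mul_nonneg_right h4 (by positivity)
    linarith
  by_contra hneg
  push Not at hneg
  -- For this `r`, `r * B ≤ A`, so `2A ≤ A`, which contradicts `0 < A`.
  have h := key (A / (B + 1)) (by positivity)
  have h7 : A / (B + 1) * B ≤ A := by
    rw [div_mul_eq_mul_div, div_le_iff₀ (by linarith)]
    nlinarith
  linarith

end Variation

/-! ### Cyclical monotonicity of the support -/

section CyclicalMonotonicity

variable {d : ℕ}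

local notation "𝔼" => EuclideanSpace ℝ (Fin d)

lemma lintegral_uniform_prod {n : ℕ} [NeZero n] {α : Type*} [MeasurableSpace α] (Q : Measure α)
    [SFinite Q] {f : Fin n × α → ℝ≥0∞} (hf : Measurable f) :
    ∫⁻ z, f z ∂(((n : ℝ≥0∞)⁻¹ • Measure.count : Measure (Fin n)).prod Q)
      = (n : ℝ≥0∞)⁻¹ * ∫⁻ w, ∑ i, f (i, w) ∂Q := by
  rw [lintegral_prod _ hf.aemeasurable, lintegral_smul_measure, lintegral_count, tsum_fintype,
    lintegral_finsetSum Finset.univ fun i _ => (by fun_prop : Measurable fun w => f (i, w))]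
  rfl

instance isProbabilityMeasure_uniform {n : ℕ} [NeZero n] :
    IsProbabilityMeasure ((n : ℝ≥0∞)⁻¹ • Measure.count : Measure (Fin n)) := by
  refine ⟨?_⟩
  rw [Measure.smul_apply, Measure.count_univ]
  simp [ENNReal.inv_mul_cancel, NeZero.ne]

/-- The hypothesis `hsum` says that, for each sample `w`, the values `Y (i, w)` rearrange the `h (w
i)`. A uniformly random index then makes the rearrangement invisible in law. -/
lemma map_eval_uniform_prod {n : ℕ} [NeZero n] {α β : Type*} [MeasurableSpace α] [MeasurableSpace β]
    {π : Measure α} [IsProbabilityMeasure π] {h : α → β} (hh : Measurable h)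
    {Y : Fin n × (Fin n → α) → β} (hY : Measurable Y)
    (hsum : ∀ (f : β → ℝ≥0∞) w, ∑ i, f (Y (i, w)) = ∑ i, f (h (w i))) :
    (((n : ℝ≥0∞)⁻¹ • Measure.count : Measure (Fin n)).prod (Measure.pi fun _ => π)).map Y
      = π.map h := by
  refine Measure.ext_of_lintegral _ fun f hf => ?_
  rw [lintegral_map hf hY, lintegral_map hf hh,
    lintegral_uniform_prod (f := fun z => f (Y z)) _ (hf.comp hY)]
  simp only [hsum]
  rw [lintegral_finsetSum Finset.univ fun i _ =>
    (by fun_prop : Measurable fun w : Fin n → α => f (h (w i)))]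
  have : ∀ i : Fin n, ∫⁻ w : Fin n → α, f (h (w i)) ∂(Measure.pi fun _ => π) = ∫⁻ x, f (h x) ∂π :=
    fun i => (measurePreserving_eval (fun _ : Fin n => π) i).lintegral_comp (hf.comp hh)
  simp only [this, Finset.sum_const, Finset.card_univ, Fintype.card_fin, nsmul_eq_mul]
  rw [← mul_assoc, ENNReal.inv_mul_cancel (by simp [NeZero.ne]) (by simp), one_mul]

/-- The support of an optimal coupling of a projection is cyclically monotone after subtracting the
second coordinate from the first one. -/
lemma sum_inner_nonpos_of_mem_support {μ ν : Measure 𝔼} (hν : ν ∈ P2 d)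
    (hμν : μ ∈ forwardProjections μ ν) {π : Measure (𝔼 × 𝔼)} (hπ : π ∈ couplings μ ν)
    (hopt : ∫⁻ p, ‖p.1 - p.2‖ₑ ^ 2 ∂π = transportCost μ ν) {n : ℕ} [NeZero n]
    (σ : Equiv.Perm (Fin n)) {w : Fin n → 𝔼 × 𝔼} (hw : ∀ i, w i ∈ π.support) :
    ∑ i, inner ℝ ((w i).1 - (w i).2) ((w (σ i)).2 - (w i).2) ≤ 0 := by
  have hμ : μ ∈ P2 d := hμν.1.1
  have := hμ.1
  have hprob : IsProbabilityMeasure π := isProbabilityMeasure_of_mem_couplings hπ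
  set S : (Fin n → 𝔼 × 𝔼) → ℝ :=
    fun w => ∑ i, inner ℝ ((w i).1 - (w i).2) ((w (σ i)).2 - (w i).2) with hS
  have hSc : Continuous S := by fun_prop
  set A : Set (Fin n → 𝔼 × 𝔼) := {w | 0 < S w} with hAdef
  have hAo : IsOpen A := isOpen_lt continuous_const hSc
  set Q : Measure (Fin n → 𝔼 × 𝔼) := Measure.pi fun _ => π with hQ
  set U : Measure (Fin n) := (n : ℝ≥0∞)⁻¹ • Measure.count with hU
  classical
  set V : Fin n × (Fin n → 𝔼 × 𝔼) → 𝔼 × 𝔼 := fun z => z.2 z.1 with hVdef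
  have hV : Measurable V := measurable_from_prod_countable_right fun i => measurable_pi_apply i
  -- The permutation acts only on samples in `A`, where it would violate the claim. Elsewhere `Y'`
  -- is the original second coordinate, so the first variation integrates the positive part of `S`,
  -- and nothing can cancel it.
  set Y' : Fin n × (Fin n → 𝔼 × 𝔼) → 𝔼 :=
    fun z => if z.2 ∈ A then (z.2 (σ z.1)).2 else (z.2 z.1).2 with hY'def
  have hY' : Measurable Y' := by
    refine measurable_from_prod_countable_right fun i => ?_
    exact Measurable.ite hAo.measurableSet (measurable_pi_apply (σ i)).snd
      (measurable_pi_apply i).snd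
  have hVπ : (U.prod Q).map V = π := by
    have := map_eval_uniform_prod (π := π) (h := id) measurable_id hV (fun f w => rfl)
    rwa [Measure.map_id] at this
  have hX : (U.prod Q).map (fun z => (V z).1) = μ := by
    rw [← hπ.1, ← hVπ, Measure.map_map measurable_fst hV]; rfl
  have hY : (U.prod Q).map (fun z => (V z).2) = ν := by
    rw [← hπ.2, ← hVπ, Measure.map_map measurable_snd hV]; rfl
  have hY'ν : (U.prod Q).map Y' = ν := by
    rw [← hπ.2]
    refine map_eval_uniform_prod (π := π) (h := Prod.snd) measurable_snd hY' fun f w => ?_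
    by_cases hwA : w ∈ A
    · simp only [hY'def, hwA, if_true]
      exact Equiv.sum_comp σ fun i => f (w i).2
    · simp only [hY'def, hwA, if_false]
  have hL2 : ∀ {η : Measure 𝔼} {F : Fin n × (Fin n → 𝔼 × 𝔼) → 𝔼}, η ∈ P2 d → Measurable F →
      (U.prod Q).map F = η → MemLp F 2 (U.prod Q) := by
    intro η F hη hF hFη
    have := memLp_id_of_mem_P2 hη
    rw [← hFη] at this
    exact (memLp_map_measure_iff aestronglyMeasurable_id hF.aemeasurable).1 this
  have hX2 := hL2 hμ hV.fst hX
  have hY2 := hL2 hν hV.snd hY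
  have hY'2 := hL2 hν hY' hY'ν
  have hopt' : ∫⁻ z, ‖(V z).1 - (V z).2‖ₑ ^ 2 ∂(U.prod Q) = transportCost μ ν := by
    rw [← hopt, ← hVπ, lintegral_map (by fun_prop) hV]
  have hle := integral_inner_sub_nonpos_of_projection hμν hV.fst hV.snd hY' hX2 hY2 hY'2 hX hY
    hY'ν hopt'
  have hint : Integrable (fun z => inner ℝ ((V z).1 - (V z).2) (Y' z - (V z).2)) (U.prod Q) :=
    integrable_inner_of_memLp_two (hX2.sub hY2) (hY'2.sub hY2)
  have hinner : ∀ w, ∫ i, inner ℝ ((V (i, w)).1 - (V (i, w)).2) (Y' (i, w) - (V (i, w)).2) ∂U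
      = (n : ℝ)⁻¹ * A.indicator S w := by
    intro w
    rw [hU, integral_smul_measure, integral_count]
    by_cases hwA : w ∈ A
    · simp [hVdef, hY'def, hwA, hS]
    · simp [hVdef, hY'def, hwA]
  rw [integral_prod_symm _ hint] at hle
  have hint2 := hint.integral_prod_right
  simp only [hinner] at hle hint2
  have hn : (0 : ℝ) < (n : ℝ)⁻¹ := by
    have : (0 : ℝ) < n := by exact_mod_cast Nat.pos_of_ne_zero (NeZero.ne n)
    positivity
  have hnn : 0 ≤ fun w => (n : ℝ)⁻¹ * A.indicator S w := fun w =>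
    mul_nonneg hn.le (Set.indicator_nonneg (fun w hw => le_of_lt hw) w)
  have hz := (integral_eq_zero_iff_of_nonneg hnn hint2).1 (le_antisymm hle (integral_nonneg hnn))
  have hQA : Q A = 0 := by
    refine measure_mono_null (fun w hw => ?_) (ae_iff.1 hz)
    have h0 : 0 < S w := hw
    simp only [Set.mem_ofPred_eq, Pi.zero_apply, Set.indicator_of_mem hw]
    positivity
  by_contra hneg
  push Not at hneg
  -- The open set `A` around `w` contains a box whose sides are neighbourhoods of support points, so
  -- the box has positive product measure.
  obtain ⟨u, hu, huA⟩ := isOpen_pi_iff'.1 hAo w hneg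
  have hpos : 0 < Q (Set.univ.pi u) := by
    rw [hQ, Measure.pi_pi]
    refine pos_iff_ne_zero.2 (Finset.prod_ne_zero_iff.2 fun i _ => ?_)
    exact (Measure.mem_support_iff_forall (w i) |>.1 (hw i) _ ((hu i).1.mem_nhds (hu i).2)).ne'
  exact hpos.ne' (measure_mono_null huA hQA)

end CyclicalMonotonicity

/-! ### Rockafellar's construction, and the convex expansion of a projection -/

section Rockafellar

variable {d : ℕ}

local notation "𝔼" => EuclideanSpace ℝ (Fin d)

/-- Rockafellar's construction: a cyclically monotone set is contained in the subdifferential of a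
supremum of affine functions `z ↦ ⟪a, z⟫ + b`. -/
lemma exists_affine_family_of_cyclicallyMonotone {Γ : Set (𝔼 × 𝔼)} {q : 𝔼 × 𝔼} (hq : q ∈ Γ)
    (hΓ : ∀ (n : ℕ) (w : ℕ → 𝔼 × 𝔼), (∀ i, w i ∈ Γ) →
      ∑ i ∈ Finset.range n, (inner ℝ (w i).1 ((w (i + 1)).2 - (w i).2) : ℝ)
        + inner ℝ (w n).1 ((w 0).2 - (w n).2) ≤ 0) :
    ∃ S : Set (𝔼 × ℝ), S.Nonempty ∧ (∀ s ∈ S, inner ℝ s.1 q.2 + s.2 ≤ 0) ∧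
      ∀ p ∈ Γ, ∀ s ∈ S, (p.1, inner ℝ s.1 p.2 + s.2 - inner ℝ p.1 p.2) ∈ S := by
  -- One affine function for each finite chain in `Γ` from `q`: its slope is that of the last point,
  -- its constant the chain sum. Closing the chain at `q` gives the bound at `q.2`; appending `p`
  -- gives the last property.
  refine ⟨{s | ∃ (n : ℕ) (w : ℕ → 𝔼 × 𝔼), (∀ i, w i ∈ Γ) ∧ w 0 = q ∧ s.1 = (w n).1 ∧
    s.2 = ∑ i ∈ Finset.range n, (inner ℝ (w i).1 ((w (i + 1)).2 - (w i).2) : ℝ)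
      - inner ℝ (w n).1 (w n).2}, ?_, ?_, ?_⟩
  · exact ⟨(q.1, - inner ℝ q.1 q.2), 0, fun _ => q, fun _ => hq, rfl, rfl, by simp⟩
  · rintro ⟨a, b⟩ ⟨n, w, hw, h0, ha, hb⟩
    have := hΓ n w hw
    simp only at ha hb ⊢
    rw [h0, inner_sub_right] at this
    rw [ha, hb]
    linarith
  · rintro p hp ⟨a, b⟩ ⟨n, w, hw, h0, ha, hb⟩
    have hlt : ∀ i ≤ n, Function.update w (n + 1) p i = w i := fun i hi =>
      Function.update_of_ne (by omega) _ _
    refine ⟨n + 1, Function.update w (n + 1) p, fun i => ?_, ?_, ?_, ?_⟩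
    · rcases eq_or_ne i (n + 1) with rfl | h
      · simpa using hp
      · rw [Function.update_of_ne h]; exact hw i
    · rw [hlt 0 (Nat.zero_le n), h0]
    · simp
    · have hsum : ∑ i ∈ Finset.range n, (inner ℝ (Function.update w (n + 1) p i).1
          ((Function.update w (n + 1) p (i + 1)).2 - (Function.update w (n + 1) p i).2) : ℝ)
          = ∑ i ∈ Finset.range n, (inner ℝ (w i).1 ((w (i + 1)).2 - (w i).2) : ℝ) := by
        refine Finset.sum_congr rfl fun i hi => ?_
        have := Finset.mem_range.1 hi
        rw [hlt i (by omega), hlt (i + 1) (by omega)]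
      simp only at ha hb
      rw [Finset.sum_range_succ, hsum, hlt n le_rfl, Function.update_self, inner_sub_right, ha, hb]
      ring

lemma legendre_ne_bot (G : 𝔼 → ℝ) (y : 𝔼) : legendre (fun x => (G x : EReal)) y ≠ ⊥ := by
  intro h
  have h1 : ((inner ℝ (0 : 𝔼) y : ℝ) : EReal) - (G 0 : EReal) ≤ ⊥ :=
    h ▸ le_iSup (fun x => ((inner ℝ x y : ℝ) : EReal) - (G x : EReal)) 0
  rw [← EReal.coe_sub] at h1
  exact EReal.coe_ne_bot _ (le_bot_iff.1 h1)

lemma legendre_le_coe_iff {G : 𝔼 → ℝ} {y : 𝔼} {M : ℝ} :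
    legendre (fun x => (G x : EReal)) y ≤ (M : EReal) ↔ ∀ x, inner ℝ x y - G x ≤ M := by
  simp only [legendre, iSup_le_iff, ← EReal.coe_sub, EReal.coe_le_coe_iff]

/-- The Legendre transform of `|x|²/2 - H` with `H` convex is a convex expansion. -/
lemma isConvexExpansion_legendre {H : 𝔼 → ℝ} (hH : ConvexOn ℝ Set.univ H) {y : 𝔼}
    (hy : legendre (fun x => ((‖x‖ ^ 2 / 2 - H x : ℝ) : EReal)) y ≠ ⊤) :
    IsConvexExpansion (legendre fun x => ((‖x‖ ^ 2 / 2 - H x : ℝ) : EReal)) := by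
  have hHc : Continuous H := hH.locallyLipschitz.continuous
  have hGc : Continuous fun x => ‖x‖ ^ 2 / 2 - H x := by fun_prop
  refine ⟨⟨legendre_ne_bot _, y, hy⟩, ?_, ?_, _, ⟨fun x => EReal.coe_ne_bot _, 0,
    EReal.coe_ne_top _⟩, (continuous_coe_real_ereal.comp hGc).upperSemicontinuous, ⟨?_, ?_, ?_⟩,
    rfl⟩
  · unfold legendre
    refine lowerSemicontinuous_iSup fun x => Continuous.lowerSemicontinuous ?_
    simp only [← EReal.coe_sub]
    exact continuous_coe_real_ereal.comp (by fun_prop)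
  · have : {p : 𝔼 × ℝ | legendre (fun x => ((‖x‖ ^ 2 / 2 - H x : ℝ) : EReal)) p.1 ≤ (p.2 : EReal)}
        = ⋂ x : 𝔼, {p : 𝔼 × ℝ | inner ℝ x p.1 - p.2 ≤ ‖x‖ ^ 2 / 2 - H x} := by
      ext p
      rw [Set.mem_iInter]
      refine legendre_le_coe_iff.trans (forall_congr' fun x => ?_)
      change _ ↔ inner ℝ x p.1 - p.2 ≤ ‖x‖ ^ 2 / 2 - H x
      constructor <;> intro h <;> linarith
    rw [ExtConvex, this]
    refine convex_iInter fun x => convex_halfSpace_le ⟨fun p r => ?_, fun c p => ?_⟩ _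
    · simp only [Prod.fst_add, Prod.snd_add, inner_add_right]; ring
    · simp only [Prod.smul_fst, Prod.smul_snd, inner_smul_right, smul_eq_mul]; ring
  · exact Eventually.of_forall fun x => ⟨EReal.coe_ne_top _, EReal.coe_ne_bot _⟩
  · simpa only [EReal.toReal_coe] using hGc.locallyIntegrable
  · intro η hη hc h0 v
    simpa only [EReal.toReal_coe] using integral_hessian_le_of_convexOn hH hη hc h0 v

/-- If `(x - y, y)` ranges over a cyclically monotone set, some convex expansion has `x` in its
subdifferential at `y`. -/
lemma exists_convexExpansion_of_cyclicallyMonotone {Γ : Set (𝔼 × 𝔼)} (hne : Γ.Nonempty)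
    (hΓ : ∀ (n : ℕ) (w : ℕ → 𝔼 × 𝔼), (∀ i, w i ∈ Γ) →
      ∑ i ∈ Finset.range n, (inner ℝ (w i).1 ((w (i + 1)).2 - (w i).2) : ℝ)
        + inner ℝ (w n).1 ((w 0).2 - (w n).2) ≤ 0) :
    ∃ G : 𝔼 → ℝ, IsConvexExpansion (legendre fun x => (G x : EReal)) ∧
      ∀ p ∈ Γ, legendre (fun x => (G x : EReal)) p.2
        ≤ ((inner ℝ (p.1 + p.2) p.2 - G (p.1 + p.2) : ℝ) : EReal) := by
  obtain ⟨q, hq⟩ := hne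
  obtain ⟨S, hSne, hSq, hSΓ⟩ := exists_affine_family_of_cyclicallyMonotone hq hΓ
  have : Nonempty S := hSne.to_subtype
  -- Chosen so that `‖x‖²/2 - H x` is the infimum of `‖x - a‖²/2 - b` over `(a, b) ∈ S`, whose
  -- Legendre transform is `‖y‖²/2 + sup (⟪a, y⟫ + b)`.
  set H : 𝔼 → ℝ := fun x => ⨆ s : S, (inner ℝ s.1.1 x - ‖s.1.1‖ ^ 2 / 2 + s.1.2) with hHdef
  have hbdd : ∀ x, BddAbove (Set.range fun s : S => inner ℝ s.1.1 x - ‖s.1.1‖ ^ 2 / 2 + s.1.2) := by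
    intro x
    refine ⟨‖x - q.2‖ ^ 2 / 2, ?_⟩
    rintro _ ⟨s, rfl⟩
    have h1 := hSq s.1 s.2
    have h2 := norm_sub_sq_real s.1.1 (x - q.2)
    rw [inner_sub_right] at h2
    have h3 := sq_nonneg ‖s.1.1 - (x - q.2)‖
    simp only
    linarith
  have hle : ∀ x, ∀ s ∈ S, inner ℝ s.1 x - ‖s.1‖ ^ 2 / 2 + s.2 ≤ H x := fun x s hs =>
    le_ciSup (hbdd x) (⟨s, hs⟩ : S)
  have hH : ConvexOn ℝ Set.univ H := by
    refine ⟨convex_univ, fun x _ y _ a b ha hb hab => ciSup_le fun s => ?_⟩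
    have h1 := mul_le_mul_of_nonneg_left (hle x s.1 s.2) ha
    have h2 := mul_le_mul_of_nonneg_left (hle y s.1 s.2) hb
    rw [inner_add_right, inner_smul_right, inner_smul_right, smul_eq_mul, smul_eq_mul]
    obtain rfl : b = 1 - a := by linarith
    linarith
  have hupper : ∀ (y : 𝔼) (M : ℝ), (∀ s ∈ S, inner ℝ s.1 y + s.2 ≤ M) →
      legendre (fun x => ((‖x‖ ^ 2 / 2 - H x : ℝ) : EReal)) y ≤ ((‖y‖ ^ 2 / 2 + M : ℝ) : EReal) := by
    intro y M hM
    refine legendre_le_coe_iff.2 fun x => ?_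
    have h4 : H x ≤ ‖y‖ ^ 2 / 2 + M + ‖x‖ ^ 2 / 2 - inner ℝ x y := by
      refine ciSup_le fun s => ?_
      have h1 := hM s.1 s.2
      have h2 := norm_sub_sq_real x (s.1.1 + y)
      rw [inner_add_right, norm_add_sq_real, real_inner_comm] at h2
      have h3 := sq_nonneg ‖x - (s.1.1 + y)‖
      linarith
    linarith
  refine ⟨fun x => ‖x‖ ^ 2 / 2 - H x, isConvexExpansion_legendre hH (y := q.2) ?_, ?_⟩
  · exact ne_top_of_le_ne_top (EReal.coe_ne_top _) (hupper q.2 0 hSq)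
  · intro p hp
    -- Extending the chain of `s` by `p` gives an element of `S` whose term in `H (p.1 + p.2)` is
    -- `‖p.1‖²/2 + ⟪s.1, p.2⟫ + s.2`; this explains the choice of `M`.
    refine (hupper p.2 (H (p.1 + p.2) - ‖p.1‖ ^ 2 / 2) fun s hs => ?_).trans ?_
    · have h1 := hle (p.1 + p.2) _ (hSΓ p hp s hs)
      simp only [inner_add_right, real_inner_self_eq_norm_sq] at h1
      linarith
    · have h1 := norm_add_sq_real p.1 p.2
      rw [EReal.coe_le_coe_iff, inner_add_left, real_inner_self_eq_norm_sq]
      simp only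
      linarith

lemma ExtConvex.convexOn_toReal {φ : 𝔼 → EReal} (hφ : ExtConvex φ) {s : Set 𝔼} (hs : Convex ℝ s)
    (hfin : ∀ x ∈ s, φ x ≠ ⊤ ∧ φ x ≠ ⊥) : ConvexOn ℝ s fun x => (φ x).toReal := by
  refine ⟨hs, fun x hx y hy a b ha hb hab => ?_⟩
  have h1 : (x, (φ x).toReal) ∈ {p : 𝔼 × ℝ | φ p.1 ≤ (p.2 : EReal)} :=
    EReal.le_coe_toReal (hfin x hx).1
  have h2 : (y, (φ y).toReal) ∈ {p : 𝔼 × ℝ | φ p.1 ≤ (p.2 : EReal)} :=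
    EReal.le_coe_toReal (hfin y hy).1
  have h3 : φ (a • x + b • y) ≤ ((a • (φ x).toReal + b • (φ y).toReal : ℝ) : EReal) :=
    hφ h1 h2 ha hb hab
  have h4 := hfin _ (hs hx hy ha hb hab)
  rwa [← EReal.coe_toReal h4.1 h4.2, EReal.coe_le_coe_iff] at h3

lemma ExtConvex.convex_domain {φ : 𝔼 → EReal} (hφ : ExtConvex φ) : Convex ℝ {x | φ x ≠ ⊤} := by
  intro x hx y hy a b ha hb hab
  have h1 : (x, (φ x).toReal) ∈ {p : 𝔼 × ℝ | φ p.1 ≤ (p.2 : EReal)} := EReal.le_coe_toReal hx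
  have h2 : (y, (φ y).toReal) ∈ {p : 𝔼 × ℝ | φ p.1 ≤ (p.2 : EReal)} := EReal.le_coe_toReal hy
  have h3 : φ (a • x + b • y) ≤ ((a • (φ x).toReal + b • (φ y).toReal : ℝ) : EReal) :=
    hφ h1 h2 ha hb hab
  exact ne_top_of_le_ne_top (EReal.coe_ne_top _) h3

/-- Rademacher's theorem on small open sets; a set that is locally null is null. -/
lemma ae_differentiableAt_of_locallyLipschitzOn {U : Set 𝔼} (hU : IsOpen U) {f : 𝔼 → ℝ}
    (hf : LocallyLipschitzOn U f) : ∀ᵐ x, x ∈ U → DifferentiableAt ℝ f x := by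
  have : volume {x | x ∈ U ∧ ¬ DifferentiableAt ℝ f x} = 0 := by
    refine measure_null_of_locally_null _ fun x hx => ?_
    obtain ⟨K, t, ht, hL⟩ := hf hx.1
    rw [hU.nhdsWithin_eq hx.1] at ht
    refine ⟨_, inter_mem_nhdsWithin _ (isOpen_interior.mem_nhds (mem_interior_iff_mem_nhds.2 ht)), ?_⟩
    have h1 := (hL.mono interior_subset).ae_differentiableWithinAt (μ := volume)
      isOpen_interior.measurableSet
    rw [ae_restrict_iff' isOpen_interior.measurableSet] at h1
    refine measure_mono_null (fun z hz => ?_) (ae_iff.1 h1)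
    intro h2
    exact hz.1.2 ((h2 hz.2).differentiableAt (isOpen_interior.mem_nhds hz.2))
  rw [ae_iff]
  simpa using this

/-- A proper convex function is differentiable almost everywhere on its domain. -/
lemma ExtConvex.ae_extDifferentiableAt {φ : 𝔼 → EReal} (hφ : ExtConvex φ) (hbot : ∀ x, φ x ≠ ⊥) :
    ∀ᵐ y, φ y ≠ ⊤ → ExtDifferentiableAt φ y := by
  have hconv := hφ.convex_domain
  set D : Set 𝔼 := {x | φ x ≠ ⊤} with hD
  have hf := hφ.convexOn_toReal hconv fun x hx => ⟨hx, hbot x⟩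
  have h1 := ae_differentiableAt_of_locallyLipschitzOn isOpen_interior hf.locallyLipschitzOn_interior
  -- The frontier of a convex set is Lebesgue null, so only the interior of the domain matters.
  have h2 : ∀ᵐ y, y ∉ frontier D := by
    rw [ae_iff]; simpa using hconv.addHaar_frontier volume
  filter_upwards [h1, h2] with y hy1 hy2 hyD
  have hyi : y ∈ interior D := by
    by_contra h
    exact hy2 ⟨subset_closure hyD, h⟩
  refine ⟨?_, hy1 hyi⟩
  filter_upwards [isOpen_interior.mem_nhds hyi] with z hz
  exact ⟨interior_subset hz, hbot z⟩

/-- Equality in Fenchel–Young holds on the support of an optimal coupling, and `φ` is differentiable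
at almost every second coordinate; so the coupling lies on the graph of the gradient. -/
lemma exists_gradient_of_mem_forwardProjections {μ ν : Measure 𝔼} (hν : ν ∈ P2 d)
    (hac : ν ≪ volume) (hμν : μ ∈ forwardProjections μ ν) :
    ∃ φ : 𝔼 → EReal, IsConvexExpansion φ ∧ GradientPushesForward φ ν μ := by
  have := hν.1
  have := hμν.1.1.1
  obtain ⟨π, hπ, hopt⟩ := exists_optimal_coupling μ ν
  have hprob := isProbabilityMeasure_of_mem_couplings hπ
  have hsupp : ∀ᵐ p ∂π, p ∈ π.support := Measure.support_mem_ae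
  set Γ : Set (𝔼 × 𝔼) := (fun p => (p.1 - p.2, p.2)) '' π.support with hΓ
  have hne : Γ.Nonempty := (Measure.nonempty_support (IsProbabilityMeasure.ne_zero π)).image _
  obtain ⟨G, hexp, hG⟩ := exists_convexExpansion_of_cyclicallyMonotone hne (by
    intro n w hw
    choose u hu huw using hw
    -- The shift by `1` on `Fin (n + 1)` sends the last index to `0` and so closes the chain.
    have h1 := sum_inner_nonpos_of_mem_support hν hμν hπ hopt (n := n + 1)
      (Equiv.addRight (1 : Fin (n + 1))) (w := fun i => u i) (fun i => hu i)
    rw [Fin.sum_univ_castSucc] at h1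
    simp only [Equiv.coe_addRight, Fin.coeSucc_eq_succ, Fin.last_add_one, Fin.val_succ,
      Fin.val_castSucc, Fin.val_last, Fin.val_zero] at h1
    simp only [← huw]
    rwa [← Fin.sum_univ_eq_sum_range
      (fun i => (inner ℝ ((u i).1 - (u i).2) ((u (i + 1)).2 - (u i).2) : ℝ))])
  set φ := legendre fun x => (G x : EReal) with hφ
  have hle : ∀ᵐ p ∂π, φ p.2 ≤ ((inner ℝ p.1 p.2 - G p.1 : ℝ) : EReal) := by
    filter_upwards [hsupp] with p hp
    simpa using hG _ ⟨p, hp, rfl⟩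
  have hdiff : ∀ᵐ y ∂ν, φ y ≠ ⊤ → ExtDifferentiableAt φ y :=
    hac.ae_le (hexp.2.2.1.ae_extDifferentiableAt hexp.1.1)
  have hdiffπ : ∀ᵐ p ∂π, ExtDifferentiableAt φ p.2 := by
    rw [← hπ.2] at hdiff
    filter_upwards [ae_of_ae_map measurable_snd.aemeasurable hdiff, hle] with p h1 h2
    exact h1 (ne_top_of_le_ne_top (EReal.coe_ne_top _) h2)
  have hfin : ∀ᵐ y ∂ν, φ y ≠ ⊤ := by
    have hm : MeasurableSet {y | φ y ≠ ⊤} :=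
      hexp.2.1.measurable (measurableSet_singleton (⊤ : EReal)).compl
    rw [← hπ.2, ae_map_iff measurable_snd.aemeasurable hm]
    filter_upwards [hle] with p h2
    exact ne_top_of_le_ne_top (EReal.coe_ne_top _) h2
  refine ⟨φ, hexp, ?_, ?_⟩
  · filter_upwards [hdiff, hfin] with y h1 h2 using h1 h2
  · have hT : ∀ᵐ p ∂π, p.1 = extGradient φ p.2 := by
      filter_upwards [hle, hdiffπ] with p h1 h2
      have h3 := ne_top_of_le_ne_top (EReal.coe_ne_top _) h1
      refine eq_extGradient_of_legendre_eq h2 (le_antisymm ?_ (inner_sub_le_of_legendre h3 _))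
      rwa [← EReal.coe_toReal h3 (legendre_ne_bot G p.2), EReal.coe_le_coe_iff] at h1
    conv_rhs => rw [← hπ.1]
    rw [Measure.map_congr (g := extGradient φ ∘ Prod.snd) hT,
      ← Measure.map_map (measurable_extGradient φ) measurable_snd, hπ.2]

end Rockafellar

end CxProj

theorem mainTheorem5 (d : ℕ) (μ ν : Measure (EuclideanSpace ℝ (Fin d)))
    (hμ : μ ∈ CxProj.P2 d) (hν : ν ∈ CxProj.P2 d) (hac : ν ≪ volume) :
    List.TFAE [
      CxProj.forwardProjections μ ν = {μ},
      μ ∈ CxProj.forwardProjections μ ν,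
      ∃ φ : EuclideanSpace ℝ (Fin d) → EReal,
        CxProj.IsConvexExpansion φ ∧ CxProj.GradientPushesForward φ ν μ] := by
  tfae_have 1 → 2 := fun h => h ▸ rfl
  tfae_have 2 → 3 := CxProj.exists_gradient_of_mem_forwardProjections hν hac
  tfae_have 3 → 1 := fun ⟨_, h1, h2⟩ =>
    CxProj.forwardProjections_eq_singleton_of_gradient hμ hν h1 h2
  tfae_finish
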